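/- Let $c>0$ and let $\lambda\in C^2\bigl((0,\infty),[0,\infty)\bigr)$ (it may happen that $\int_0^t\lambda(s)\,ds=\infty$). Let $\{(X(t),Y(t))\}_{t\ge0}$ be the standard orthogonal planar random motion with speed $c$ and rate function $\lambda$: the particle starts at the origin and moves with speed $c$ in one of the directions $d_k=(\cos(k\pi/2),\sin(k\pi/2))$, $k=0,1,2,3$; at every event of a non-homogeneous Poisson process with rate function $\lambda(t)$ it turns from its current direction $d_k$ to $d_{k+1}$ or $d_{k-1}$ (indices modulo $4$) with probability $1/2$ each, independently of everything else; the direction is uniformly distributed on $\{d_0,d_1,d_2,d_3\}$ at every time and independent of the subsequent Poisson events and choices. Let $\{U(t)\}_{t\ge0}$ and $\{V(t)\}_{t\ge0}$ be two independent one-dimensional telegraph processes with parameters $(c/2,\lambda(t)/2)$: each starts at $0$ and moves with velocity $\pm c/2$, both signs being equally likely at every time and the current sign being independent of the subsequent events, and the velocity is reversed at every event of a Poisson process with rate function $\lambda(t)/2$. Then the process $\{(X(t),Y(t))\}_{t\ge0}$ is equal in distribution to the process $\{(U(t)+V(t),\,U(t)-V(t))\}_{t\ge0}$. Moreover, for $t>0$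 let $p_U(\cdot,t)$ and $p_V(\cdot,t)$ be the densities of the absolutely continuous components of the laws of $U(t)$ and $V(t)$. Then the absolutely continuous component of the law of $(X(t),Y(t))$ has density $$p(x,y,t)=\tfrac12\,p_U\Bigl(\frac{x+y}{2},t\Bigr)\,p_V\Bigl(\frac{x-y}{2},t\Bigr),$$ and in the interior $\{|x|+|y|<ct\}$ of the square $\{|x|+|y|\le ct\}$ the law of $(X(t),Y(t))$ is absolutely continuous with this density. If in addition $\Lambda(t)=\int_0^t\lambda(s)\,ds<\infty$, then on the edge of the square in the first quadrant, for $|\eta|<ct$, $$P\{X(t)+Y(t)=ct,\ X(t)-Y(t)\in d\eta\}=f(\eta,t)\,d\eta,\qquad f(\eta,t)=\tfrac14\,e^{-\Lambda(t)/2}\,p_V\Bigl(\frac{\eta}{2},t\Bigr).$$ -/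

import Mathlib

open MeasureTheory ProbabilityTheory Set
open scoped NNReal ENNReal

/-- The number of points of the random set `T` of event times in the interval `(s, t]`. -/
noncomputable def eventCount {Ω : Type*} (T : Ω → Set ℝ) (s t : ℝ) (ω : Ω) : ℕ :=
  (T ω ∩ Ioc s t).ncard

/-- `T` is the random set of event times of a non-homogeneous Poisson process on `(0, ∞)` with
rate function `rate`: finitely many events in each `(s, t]` with `0 < s`, numbers of events that
are Poisson distributed with mean `∫_s^t rate`, and independent over successive intervals.
The events may accumulate at time `0`; this happens exactly when `∫_0^t rate = ∞`. -/
structure IsPoissonEvents {Ω : Type*} [MeasurableSpace Ω] (rate : ℝ → ℝ) (T : Ω → Set ℝ)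
    (P : Measure Ω) : Prop where
  finite : ∀ ω s t, 0 < s → (T ω ∩ Ioc s t).Finite
  measurable : ∀ s t, 0 < s → Measurable (eventCount T s t)
  hasLaw : ∀ s t, 0 < s → s ≤ t →
    HasLaw (eventCount T s t) (poissonMeasure (∫ r in s..t, rate r).toNNReal) P
  indep : ∀ t : ℕ → ℝ, Monotone t → 0 < t 0 →
    iIndepFun (fun (i : ℕ) ω ↦ eventCount T (t i) (t (i + 1)) ω) P

/-- `S t`, `t > 0`, is the sign of the velocity at time `t` of a telegraph process whose changes
of sign are paced by the Poisson events `T`. At any time `s > 0` both signs are equally likely and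
the current sign is independent of the events after `s`; the sign is reversed at every event.
The evolution is described from positive times because the events may accumulate at time `0`;
if they do not, this says that the initial sign is uniform and independent of the events. -/
structure IsTelegraphSign {Ω : Type*} [MeasurableSpace Ω] (rate : ℝ → ℝ)
    (T : Ω → Set ℝ) (S : ℝ → Ω → ℝ) (P : Measure Ω) : Prop where
  events : IsPoissonEvents rate T P
  measurable : ∀ s, 0 < s → Measurable (S s)
  sign : ∀ s, 0 < s → ∀ ω, S s ω = 1 ∨ S s ω = -1
  uniform : ∀ s, 0 < s → P {ω | S s ω = 1} = 1 / 2 ∧ P {ω | S s ω = -1} = 1 / 2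
  indep : ∀ s, 0 < s → IndepFun (S s) (fun ω (t : ℝ) ↦ eventCount T s t ω) P
  switch : ∀ s t, 0 < s → s ≤ t → ∀ ω, S t ω = S s ω * (-1) ^ eventCount T s t ω

/-- `U` is a one-dimensional telegraph process with parameters `(v, rate)`: it starts at the
origin and moves with velocity `v` or `-v`, the velocity being reversed at the events of a
Poisson process with rate function `rate`. -/
def IsTelegraphProcess {Ω : Type*} [MeasurableSpace Ω] (v : ℝ) (rate : ℝ → ℝ)
    (U : ℝ≥0 → Ω → ℝ) (P : Measure Ω) : Prop :=
  ∃ (T : Ω → Set ℝ) (S : ℝ → Ω → ℝ), IsTelegraphSign rate T S P ∧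
    ∀ (t : ℝ≥0) (ω : Ω), U t ω = ∫ r in (0 : ℝ)..t, v * S r ω

/-- The four orthogonal directions `d_k = (cos (k π / 2), sin (k π / 2))`, `k = 0, 1, 2, 3`. -/
noncomputable def orthogonalDirection (k : ZMod 4) : ℝ × ℝ :=
  (Real.cos (k.val * Real.pi / 2), Real.sin (k.val * Real.pi / 2))

/-- `D t`, `t > 0`, is (the index of) the direction at time `t` of a standard orthogonal planar
motion whose changes of direction are paced by the Poisson events `T`. Seen from any time `s > 0`,
the direction `D s` is uniformly distributed, and at the `k`-th event after `s` (`k = 0, 1, …`)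
the index moves by `ξ k`, which is `1` or `-1` with probability `1 / 2` each; the steps, the
events after `s` and the current direction are independent. The evolution is described from
positive times because the events may accumulate at time `0`; if they do not, this says that
the initial direction is uniform and independent of the events and of the steps. -/
structure IsOrthogonalDirectionProcess {Ω : Type*} [MeasurableSpace Ω] (rate : ℝ → ℝ)
    (T : Ω → Set ℝ) (D : ℝ → Ω → ZMod 4) (P : Measure Ω) : Prop where
  events : IsPoissonEvents rate T P
  measurable : ∀ s, 0 < s → Measurable (D s)
  uniform : ∀ s, 0 < s → ∀ k, P {ω | D s ω = k} = 1 / 4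
  switch : ∀ s, 0 < s → ∃ ξ : ℕ → Ω → ZMod 4,
    (∀ k, Measurable (ξ k)) ∧
    (∀ k, P {ω | ξ k ω = 1} = 1 / 2 ∧ P {ω | ξ k ω = -1} = 1 / 2) ∧
    iIndepFun ξ P ∧
    IndepFun (fun ω k ↦ ξ k ω) (fun ω (t : ℝ) ↦ eventCount T s t ω) P ∧
    IndepFun (D s) (fun ω ↦ ((fun k ↦ ξ k ω), (fun (t : ℝ) ↦ eventCount T s t ω))) P ∧
    ∀ t, s ≤ t → ∀ ω, D t ω = D s ω + ∑ k ∈ Finset.range (eventCount T s t ω), ξ k ω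

/-- `(X, Y)` is a standard orthogonal planar random motion with speed `c`, starting at the origin,
whose changes of direction are governed by a Poisson process with rate function `rate`: at every
Poisson event the particle turns, with probability `1 / 2` each, to one of the two directions
orthogonal to the current one. -/
def IsStandardOrthogonalMotion {Ω : Type*} [MeasurableSpace Ω] (c : ℝ) (rate : ℝ → ℝ)
    (X Y : ℝ≥0 → Ω → ℝ) (P : Measure Ω) : Prop :=
  ∃ (T : Ω → Set ℝ) (D : ℝ → Ω → ZMod 4), IsOrthogonalDirectionProcess rate T D P ∧
    ∀ (t : ℝ≥0) (ω : Ω),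
      X t ω = ∫ r in (0 : ℝ)..t, c * (orthogonalDirection (D r ω)).1 ∧
      Y t ω = ∫ r in (0 : ℝ)..t, c * (orthogonalDirection (D r ω)).2

/-- The density of the absolutely continuous component (with respect to Lebesgue measure) of the
law of the random variable `Z` under `P`. -/
noncomputable def acDensity {Ω E : Type*} [MeasurableSpace Ω] [MeasureSpace E] (Z : Ω → E)
    (P : Measure Ω) : E → ℝ≥0∞ :=
  (P.map Z).rnDeriv volume

/-!
The idea is to rotate the coordinates by half a right angle. The signs of `x + y` and `x - y` for
the current direction of the planar motion determine that direction, and each turn reverses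
exactly one of the two signs, each of them with probability `1 / 2`. By the thinning of Poisson
processes the two signs should be independent telegraph signs of half the rate, and integrating
them gives `X + Y = 2 U` and `X - Y = 2 V` in law.

Thinning is replaced by a computation of finite-dimensional laws. Given the numbers of events in
successive intervals, the increments of the index of the direction are sums of independent fair
steps in `ZMod 4`, with the explicit probabilities `walkProb` (`measureReal_blocks`). The average
of `walkProb` over a Poisson number of steps is a product of two factors, one for each sign
(`lintegral_walkProb`), and these factors are the transition probabilities of telegraph signs of
half the rate. Comparing `IsOrthogonalDirectionProcess.measure_path` with
`IsTelegraphSign.measure_path` gives the equality in law of the direction processes. The positions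
are obtained from the directions by the functional `pathIntegral`, which is measurable for the
product σ-algebra and agrees with the integral along paths that are locally constant to the right;
hence the equality in law of the processes (`IsStandardOrthogonalMotion.identDistrib`). All of this
takes place at positive times, since the events may accumulate at time `0`.

For the densities at a fixed time, the law of `(X, Y)` is the image of a product measure under
`(u, v) ↦ (u + v, u - v)`, which halves Lebesgue measure, and the density of the absolutely
continuous component of a product is the product of the densities (`rnDeriv_prod`). It remains to
know the law of one telegraph process. Inside its range that law is absolutely continuous
(`IsTelegraphProcess.restrict_absolutelyContinuous`): there at least one event has occurred, some
rational time `a` separates the last event from the previous ones, and the position depends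
affinely on the time of the single event after `a`, which has a density and is independent of the
signs up to `a`. The right end of the range has the probability that the sign is `1` and no
event occurs (`IsTelegraphProcess.measure_eq_mul`), which gives the factor on the edge of the
square.
-/

open Filter Topology

/-! ### Counting events -/

section EventCount

variable {Ω : Type*} {T : Ω → Set ℝ} {ω : Ω}

lemma eventCount_of_le {s t : ℝ} (h : t ≤ s) : eventCount T s t ω = 0 := by
  simp [eventCount, Ioc_eq_empty_of_le h]

lemma eventCount_add (hT : ∀ s t, 0 < s → (T ω ∩ Ioc s t).Finite) {a b c : ℝ} (ha : 0 < a)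
    (hab : a ≤ b) (hbc : b ≤ c) :
    eventCount T a c ω = eventCount T a b ω + eventCount T b c ω := by
  unfold eventCount
  rw [← Ioc_union_Ioc_eq_Ioc hab hbc, inter_union_distrib_left, ncard_union_eq _ (hT _ _ ha)
    (hT _ _ (ha.trans_le hab))]
  exact (Ioc_disjoint_Ioc_of_le le_rfl).mono inter_subset_right inter_subset_right

lemma eventCount_eq_zero_iff (hT : ∀ s t, 0 < s → (T ω ∩ Ioc s t).Finite) {s t : ℝ} (hs : 0 < s) :
    eventCount T s t ω = 0 ↔ T ω ∩ Ioc s t = ∅ :=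
  ncard_eq_zero (hT s t hs)

lemma eventCount_eq_sum (hT : ∀ s t, 0 < s → (T ω ∩ Ioc s t).Finite) {t : ℕ → ℝ} (ht : Monotone t)
    (h0 : 0 < t 0) {i j : ℕ} (hij : i ≤ j) :
    eventCount T (t i) (t j) ω = ∑ k ∈ Finset.Ico i j, eventCount T (t k) (t (k + 1)) ω := by
  induction j, hij using Nat.le_induction with
  | base => simp [eventCount_of_le]
  | succ j hij ih =>
    rw [Finset.sum_Ico_succ_top hij, ← ih]
    exact eventCount_add hT (h0.trans_le (ht (Nat.zero_le i))) (ht hij) (ht j.le_succ)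

/-- Locally finitely many events leave an event-free interval to the right of each time. -/
lemma eventually_eventCount_eq_zero (hT : ∀ s t, 0 < s → (T ω ∩ Ioc s t).Finite) {r : ℝ}
    (hr : 0 < r) : ∀ᶠ s in 𝓝[>] r, eventCount T r s ω = 0 := by
  have hfin := hT r (r + 1) hr
  have h1 : ∀ᶠ s in 𝓝[>] r, ∀ x ∈ T ω ∩ Ioc r (r + 1), s < x := by
    rw [eventually_all_finite hfin]
    intro x hx
    exact nhdsWithin_le_nhds (eventually_lt_nhds hx.2.1)
  have h2 : ∀ᶠ s in 𝓝[>] r, s < r + 1 :=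
    nhdsWithin_le_nhds (eventually_lt_nhds (by linarith))
  filter_upwards [h1, h2] with s h1 h2
  rw [eventCount_eq_zero_iff hT hr]
  refine eq_empty_of_forall_notMem fun x hx ↦ ?_
  exact (h1 x ⟨hx.1, hx.2.1, hx.2.2.trans h2.le⟩).not_ge hx.2.2

end EventCount

/-! ### Integrals along right-constant paths -/

section PathIntegral

variable {E : Type*}

/-- A path on the positive half-line that stays constant for some time after each instant. -/
def RightConstant (d : ℝ → E) : Prop := ∀ r, 0 < r → ∀ᶠ s in 𝓝[>] r, d s = d r

/-- The first multiple of `1 / (n + 1)` after time `r`. -/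
noncomputable def gridTime (n : ℕ) (r : ℝ) : Ioi (0 : ℝ) :=
  ⟨(⌊(n + 1) * r⌋₊ + 1) / (n + 1), by simp only [mem_Ioi]; positivity⟩

/-- The integral `∫_0^t h (d r) dr` along a path `d`, written as a limit of integrals along
discretized paths, so that it is a measurable function on the path space with its product
σ-algebra. -/
noncomputable def pathIntegral (h : E → ℝ) (d : Ioi (0 : ℝ) → E) (t : ℝ) : ℝ :=
  limsup (fun n ↦ ∫ r in (0 : ℝ)..t, h (d (gridTime n r))) atTop

lemma lt_gridTime (n : ℕ) {r : ℝ} : r < gridTime n r := by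
  have hn : (0 : ℝ) < n + 1 := by positivity
  simp only [gridTime]
  rw [lt_div_iff₀ hn, mul_comm]
  exact Nat.lt_floor_add_one _

lemma gridTime_le (n : ℕ) {r : ℝ} (hr : 0 ≤ r) : (gridTime n r : ℝ) ≤ r + 1 / (n + 1) := by
  have hn : (0 : ℝ) < n + 1 := by positivity
  simp only [gridTime]
  rw [div_le_iff₀ hn]
  have h1 : (r + 1 / ((n : ℝ) + 1)) * (n + 1) = (n + 1) * r + 1 := by field_simp
  rw [h1]
  gcongr
  exact Nat.floor_le (by positivity)

lemma tendsto_gridTime {r : ℝ} (hr : 0 ≤ r) :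
    Tendsto (fun n ↦ (gridTime n r : ℝ)) atTop (𝓝[>] r) := by
  refine tendsto_nhdsWithin_iff.2 ⟨?_, Eventually.of_forall fun n ↦ lt_gridTime n⟩
  refine tendsto_of_tendsto_of_tendsto_of_le_of_le tendsto_const_nhds (g := fun _ ↦ r)
    (h := fun n : ℕ ↦ r + 1 / ((n : ℝ) + 1)) ?_ (fun n ↦ (lt_gridTime n).le)
    (fun n ↦ gridTime_le n hr)
  simpa using tendsto_one_div_add_atTop_nhds_zero_nat.const_add r

/-- The grid times approach `r` from the right, where the path is eventually constant. -/
lemma tendsto_comp_gridTime (h : E → ℝ) {d : ℝ → E} (hd : RightConstant d) {r : ℝ} (hr : 0 < r) :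
    Tendsto (fun n ↦ h (d (gridTime n r))) atTop (𝓝 (h (d r))) := by
  refine tendsto_const_nhds.congr' ?_
  filter_upwards [(tendsto_gridTime hr.le).eventually (hd r hr)] with n hn
  rw [hn]

variable [MeasurableSpace E]

/-- Joint measurability in the path and the time holds because `gridTime n` has countably many
values. -/
lemma measurable_uncurry_comp_gridTime {h : E → ℝ} (hh : Measurable h) (n : ℕ) :
    Measurable fun p : (Ioi (0 : ℝ) → E) × ℝ ↦ h (p.1 (gridTime n p.2)) := by
  let g : ℕ → Ioi (0 : ℝ) := fun k ↦ ⟨(k + 1) / (n + 1), by simp only [mem_Ioi]; positivity⟩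
  have h1 : Measurable fun q : (Ioi (0 : ℝ) → E) × ℕ ↦ h (q.1 (g q.2)) := by
    refine measurable_from_prod_countable_left fun k ↦ hh.comp ?_
    exact measurable_pi_apply (g k)
  have h2 : Measurable fun p : (Ioi (0 : ℝ) → E) × ℝ ↦ (p.1, ⌊(n + 1) * p.2⌋₊) :=
    measurable_fst.prodMk (Nat.measurable_floor.comp (measurable_snd.const_mul _))
  exact h1.comp h2

lemma measurable_pathIntegral {h : E → ℝ} (hh : Measurable h) (t : ℝ) :
    Measurable fun d ↦ pathIntegral h d t := by
  refine Measurable.limsup fun n ↦ ?_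
  have h1 := (measurable_uncurry_comp_gridTime hh n).stronglyMeasurable
  simp only [intervalIntegral]
  exact h1.integral_prod_right.measurable.sub h1.integral_prod_right.measurable

lemma measurable_comp_gridTime {h : E → ℝ} (hh : Measurable h) (d : Ioi (0 : ℝ) → E) (n : ℕ) :
    Measurable fun r ↦ h (d (gridTime n r)) :=
  (measurable_uncurry_comp_gridTime hh n).comp measurable_prodMk_left

lemma RightConstant.aestronglyMeasurable {h : E → ℝ} (hh : Measurable h) {d : ℝ → E}
    (hd : RightConstant d) (t : ℝ) :
    AEStronglyMeasurable (fun r ↦ h (d r)) (volume.restrict (Ioc 0 t)) := by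
  refine aestronglyMeasurable_of_tendsto_ae atTop
    (fun n ↦ (measurable_comp_gridTime hh (fun r ↦ d r) n).aestronglyMeasurable) ?_
  filter_upwards [ae_restrict_mem measurableSet_Ioc] with r hr
  exact tendsto_comp_gridTime h hd hr.1

lemma RightConstant.intervalIntegrable {h : E → ℝ} (hh : Measurable h) {d : ℝ → E}
    (hd : RightConstant d) {C : ℝ} (hC : ∀ r, 0 < r → |h (d r)| ≤ C) {s t : ℝ} (hs : 0 ≤ s)
    (ht : 0 ≤ t) : IntervalIntegrable (fun r ↦ h (d r)) volume s t := by
  have key : ∀ t : ℝ, 0 ≤ t → IntervalIntegrable (fun r ↦ h (d r)) volume 0 t := by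
    intro t ht
    rw [intervalIntegrable_iff_integrableOn_Ioc_of_le ht]
    refine (integrable_const C).mono' (hd.aestronglyMeasurable hh t) ?_
    filter_upwards [ae_restrict_mem measurableSet_Ioc] with r hr using hC r hr.1
  exact (key s hs).symm.trans (key t ht)

/-- The discretized integrals converge to the integral along the path by dominated
convergence. -/
lemma RightConstant.pathIntegral_eq {h : E → ℝ} (hh : Measurable h) {d : ℝ → E}
    (hd : RightConstant d) {C : ℝ} (hC : ∀ r, 0 < r → |h (d r)| ≤ C) {t : ℝ} (ht : 0 ≤ t) :
    pathIntegral h (fun r ↦ d r) t = ∫ r in (0 : ℝ)..t, h (d r) := by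
  refine Tendsto.limsup_eq ?_
  refine intervalIntegral.tendsto_integral_filter_of_dominated_convergence (fun _ ↦ C) ?_ ?_ ?_ ?_
  · exact Eventually.of_forall fun n ↦
      (measurable_comp_gridTime hh (fun r ↦ d r) n).aestronglyMeasurable
  · exact Eventually.of_forall fun n ↦ Eventually.of_forall fun r _ ↦ hC _ (gridTime n r).2
  · simp
  · refine Eventually.of_forall fun r hr ↦ ?_
    rw [uIoc_of_le ht] at hr
    exact tendsto_comp_gridTime h hd hr.1

end PathIntegral

/-! ### Random walks with independent fair steps on the four directions -/

/-- The sign of `x + y` for the direction `(x, y)` of index `k`. -/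
noncomputable def sumSign (k : ZMod 4) : ℝ := if k = 0 ∨ k = 1 then 1 else -1

/-- The sign of `x - y` for the direction `(x, y)` of index `k`. -/
noncomputable def diffSign (k : ZMod 4) : ℝ := if k = 0 ∨ k = 3 then 1 else -1

/-- The probability that `n` independent steps `±1`, each with probability `1 / 2`, add up to `w`
in `ZMod 4`, as a closed formula: for `n > 0` the sum is uniform on the two residues with the
parity of `n`, and `sumSign w * diffSign w` is `1` or `-1` according to the parity of `w`. -/
noncomputable def walkProb (n : ℕ) (w : ZMod 4) : ℝ :=
  (1 + (if n = 0 then sumSign w + diffSign w else 0) + sumSign w * diffSign w * (-1) ^ n) / 4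

lemma ZMod.four_cases (w : ZMod 4) : w = 0 ∨ w = 1 ∨ w = 2 ∨ w = 3 := by
  revert w; decide

lemma sumSign_zero : sumSign 0 = 1 := by simp [sumSign]
lemma sumSign_one : sumSign 1 = 1 := by simp [sumSign]
lemma sumSign_two : sumSign 2 = -1 := by
  rw [sumSign, if_neg (by decide)]
lemma sumSign_three : sumSign 3 = -1 := by
  rw [sumSign, if_neg (by decide)]
lemma diffSign_zero : diffSign 0 = 1 := by simp [diffSign]
lemma diffSign_one : diffSign 1 = -1 := by
  rw [diffSign, if_neg (by decide)]
lemma diffSign_two : diffSign 2 = -1 := by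
  rw [diffSign, if_neg (by decide)]
lemma diffSign_three : diffSign 3 = 1 := by simp [diffSign]

lemma walkProb_zero (w : ZMod 4) : walkProb 0 w = if w = 0 then 1 else 0 := by
  rcases ZMod.four_cases w with rfl | rfl | rfl | rfl
  · norm_num [walkProb, sumSign_zero, diffSign_zero]
  · rw [if_neg (by decide)]; norm_num [walkProb, sumSign_one, diffSign_one]
  · rw [if_neg (by decide)]; norm_num [walkProb, sumSign_two, diffSign_two]
  · rw [if_neg (by decide)]; norm_num [walkProb, sumSign_three, diffSign_three]

lemma walkProb_succ (n : ℕ) (w : ZMod 4) :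
    walkProb (n + 1) w = (walkProb n (w - 1) + walkProb n (w + 1)) / 2 := by
  have e1 : (0 : ZMod 4) - 1 = 3 := by decide
  have e2 : (2 : ZMod 4) - 1 = 1 := by decide
  have e3 : (3 : ZMod 4) - 1 = 2 := by decide
  have e4 : (1 : ZMod 4) + 1 = 2 := by decide
  have e5 : (2 : ZMod 4) + 1 = 3 := by decide
  have e6 : (3 : ZMod 4) + 1 = 0 := by decide
  rcases ZMod.four_cases w with rfl | rfl | rfl | rfl <;>
  rcases n.eq_zero_or_pos with rfl | hn <;>
  simp only [walkProb, e1, e2, e3, e4, e5, e6, sub_self, zero_add, sumSign_zero, sumSign_one,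
    sumSign_two, sumSign_three, diffSign_zero, diffSign_one, diffSign_two, diffSign_three,
    pow_succ] <;>
  first
  | (simp only [hn.ne', if_false, Nat.succ_ne_zero]; ring)
  | norm_num

lemma walkProb_nonneg (n : ℕ) (w : ZMod 4) : 0 ≤ walkProb n w := by
  induction n generalizing w with
  | zero => rw [walkProb_zero]; split_ifs <;> norm_num
  | succ n ih => rw [walkProb_succ]; linarith [ih (w - 1), ih (w + 1)]

section Walk

variable {Ω : Type*} [MeasurableSpace Ω] {P : Measure Ω} {ξ : ℕ → Ω → ZMod 4}

/-- A set of sequences that depends only on the first `K` terms is the preimage of a set of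
finite sequences. -/
lemma measurableSet_of_forall_lt {F : Set (ℕ → ZMod 4)} {K : ℕ}
    (hF : ∀ x y : ℕ → ZMod 4, (∀ i < K, x i = y i) → (x ∈ F ↔ y ∈ F)) :
    ∃ G : Set (Finset.range K → ZMod 4), MeasurableSet G ∧
      ∀ x : ℕ → ZMod 4, (x ∈ F ↔ (fun i : Finset.range K ↦ x i) ∈ G) := by
  classical
  refine ⟨{y | (fun i ↦ if h : i ∈ Finset.range K then y ⟨i, h⟩ else 0) ∈ F},
    .of_discrete, fun x ↦ hF _ _ fun i hi ↦ ?_⟩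
  simp [hi]

/-- An event about the first `K` steps is independent of the next step. -/
lemma measureReal_inter_step (hm : ∀ k, Measurable (ξ k)) (hi : iIndepFun ξ P)
    {F : Set (ℕ → ZMod 4)} {K : ℕ}
    (hF : ∀ x y : ℕ → ZMod 4, (∀ i < K, x i = y i) → (x ∈ F ↔ y ∈ F)) (e : ZMod 4) :
    P.real ({ω | (fun k ↦ ξ k ω) ∈ F} ∩ {ω | ξ K ω = e}) =
      P.real {ω | (fun k ↦ ξ k ω) ∈ F} * P.real {ω | ξ K ω = e} := by
  obtain ⟨G, hG, hFG⟩ := measurableSet_of_forall_lt hF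
  have h := hi.indepFun_finset (Finset.range K) {K} (by simp) hm
  have h2 := h.measure_inter_preimage_eq_mul G {y | y ⟨K, by simp⟩ = e} hG .of_discrete
  simp only [measureReal_def, ← ENNReal.toReal_mul]
  simp only [hFG]
  exact congrArg ENNReal.toReal h2

variable [IsProbabilityMeasure P]

/-- Block sums of a fair walk: `n` steps after time `K` are independent of an event about the
first `K` steps. -/
lemma measureReal_inter_block (hm : ∀ k, Measurable (ξ k))
    (hfair : ∀ k, P {ω | ξ k ω = 1} = 1 / 2 ∧ P {ω | ξ k ω = -1} = 1 / 2) (hi : iIndepFun ξ P)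
    {F : Set (ℕ → ZMod 4)} {K : ℕ}
    (hF : ∀ x y : ℕ → ZMod 4, (∀ i < K, x i = y i) → (x ∈ F ↔ y ∈ F)) (n : ℕ) (w : ZMod 4) :
    P.real {ω | (fun k ↦ ξ k ω) ∈ F ∧ ∑ k ∈ Finset.Ico K (K + n), ξ k ω = w} =
      P.real {ω | (fun k ↦ ξ k ω) ∈ F} * walkProb n w := by
  induction n generalizing w with
  | zero =>
    rw [walkProb_zero]
    by_cases hw : w = 0
    · simp [hw]
    · simp [hw, Ne.symm hw]
  | succ n ih =>
    set E := {ω | (fun k ↦ ξ k ω) ∈ F ∧ ∑ k ∈ Finset.Ico K (K + (n + 1)), ξ k ω = w}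
    have hone : MeasurableSet {ω | ξ (K + n) ω = 1} := hm (K + n) (measurableSet_singleton 1)
    have hsum : ∀ x : ℕ → ZMod 4, ∑ k ∈ Finset.Ico K (K + (n + 1)), x k =
        ∑ k ∈ Finset.Ico K (K + n), x k + x (K + n) := fun x ↦ by
      rw [← add_assoc, Finset.sum_Ico_succ_top (by lia)]
    have hF' : ∀ v : ZMod 4, ∀ x y : ℕ → ZMod 4, (∀ i < K + n, x i = y i) →
        (x ∈ {x | x ∈ F ∧ ∑ k ∈ Finset.Ico K (K + n), x k = v} ↔
          y ∈ {x | x ∈ F ∧ ∑ k ∈ Finset.Ico K (K + n), x k = v}) := by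
      intro v x y hxy
      have h1 : ∑ k ∈ Finset.Ico K (K + n), x k = ∑ k ∈ Finset.Ico K (K + n), y k :=
        Finset.sum_congr rfl fun k hk ↦ hxy k (Finset.mem_Ico.1 hk).2
      simp only [mem_ofPred_eq, h1, hF x y fun i hi ↦ hxy i (by lia)]
    have step : ∀ v e : ZMod 4, P.real ({ω | (fun k ↦ ξ k ω) ∈ F ∧
        ∑ k ∈ Finset.Ico K (K + n), ξ k ω = v} ∩ {ω | ξ (K + n) ω = e}) =
        P.real {ω | (fun k ↦ ξ k ω) ∈ F} * walkProb n v * P.real {ω | ξ (K + n) ω = e} := by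
      intro v e
      rw [← ih v]
      exact measureReal_inter_step hm hi (hF' v) e
    have hae : ∀ᵐ ω ∂P, ξ (K + n) ω = 1 ∨ ξ (K + n) ω = -1 := by
      have hne : (1 : ZMod 4) ≠ -1 := by decide
      have hd : Disjoint {ω | ξ (K + n) ω = 1} {ω | ξ (K + n) ω = -1} :=
        disjoint_left.2 fun ω h1 h2 ↦ hne (h1.symm.trans h2)
      have hmeas : MeasurableSet {ω | ξ (K + n) ω = -1} := hm (K + n) (measurableSet_singleton _)
      have h1 : P ({ω | ξ (K + n) ω = 1} ∪ {ω | ξ (K + n) ω = -1}) = 1 := by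
        rw [measure_union hd hmeas, (hfair _).1, (hfair _).2]
        exact ENNReal.add_halves 1
      exact (prob_compl_eq_zero_iff (hone.union hmeas)).2 h1
    have hE1 : E ∩ {ω | ξ (K + n) ω = 1} = {ω | (fun k ↦ ξ k ω) ∈ F ∧
        ∑ k ∈ Finset.Ico K (K + n), ξ k ω = w - 1} ∩ {ω | ξ (K + n) ω = 1} := by
      ext ω
      simp only [E, hsum, mem_inter_iff, mem_ofPred_eq]
      refine and_congr_left fun h ↦ ?_
      rw [h, eq_sub_iff_add_eq]
    have hE2 : (E \ {ω | ξ (K + n) ω = 1} : Set Ω) =ᵐ[P] ({ω | (fun k ↦ ξ k ω) ∈ F ∧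
        ∑ k ∈ Finset.Ico K (K + n), ξ k ω = w + 1} ∩ {ω | ξ (K + n) ω = -1} : Set Ω) := by
      refine eventuallyEq_set.2 ?_
      filter_upwards [hae] with ω hω
      simp only [E, hsum, Set.mem_sdiff, mem_inter_iff, mem_ofPred_eq]
      rcases hω with h | h
      · have hne : ¬ (1 : ZMod 4) = -1 := by decide
        simp [h, hne]
      · have hne : ¬ (-1 : ZMod 4) = 1 := by decide
        simp [h, hne, ← sub_eq_add_neg, sub_eq_iff_eq_add]
    have h1 : P.real {ω | ξ (K + n) ω = 1} = 1 / 2 := by simp [measureReal_def, (hfair _).1]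
    have h2 : P.real {ω | ξ (K + n) ω = -1} = 1 / 2 := by simp [measureReal_def, (hfair _).2]
    rw [← measureReal_inter_add_sdiff hone, hE1, measureReal_congr hE2, step, step, h1, h2,
      walkProb_succ]
    ring

/-- The increments of a fair walk over successive blocks of given lengths. -/
lemma measureReal_blocks (hm : ∀ k, Measurable (ξ k))
    (hfair : ∀ k, P {ω | ξ k ω = 1} = 1 / 2 ∧ P {ω | ξ k ω = -1} = 1 / 2) (hi : iIndepFun ξ P)
    (n : ℕ → ℕ) (w : ℕ → ZMod 4) (m : ℕ) :
    P.real {ω | ∀ j < m, ∑ k ∈ Finset.Ico (∑ i ∈ Finset.range j, n i)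
      (∑ i ∈ Finset.range (j + 1), n i), ξ k ω = w j} =
      ∏ j ∈ Finset.range m, walkProb (n j) (w j) := by
  induction m with
  | zero => simp
  | succ m ih =>
    rw [Finset.prod_range_succ, ← ih]
    have := measureReal_inter_block hm hfair hi (K := ∑ i ∈ Finset.range m, n i)
      (F := {x | ∀ j < m, ∑ k ∈ Finset.Ico (∑ i ∈ Finset.range j, n i)
      (∑ i ∈ Finset.range (j + 1), n i), x k = w j}) ?_ (n m) (w m)
    · rw [← Finset.sum_range_succ] at this
      refine Eq.trans ?_ this
      congr 1
      ext ω
      exact Nat.forall_lt_succ_right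
    · intro x y hxy
      simp only [mem_ofPred_eq]
      refine forall₂_congr fun j hj ↦ ?_
      rw [Finset.sum_congr rfl fun k hk ↦ hxy k ?_]
      refine (Finset.mem_Ico.1 hk).2.trans_le ?_
      exact Finset.sum_le_sum_of_subset (Finset.range_subset_range.2 hj)

end Walk

/-! ### Poisson averages -/

lemma hasSum_poissonMeasure_neg_one_pow (μ : ℝ≥0) :
    HasSum (fun n : ℕ ↦ Real.exp (-μ) * (μ : ℝ) ^ n / (n.factorial : ℝ) * (-1) ^ n)
      (Real.exp (-(2 * μ))) := by
  have h := (NormedSpace.expSeries_div_hasSum_exp (-(μ : ℝ))).mul_left (Real.exp (-μ))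
  rw [← Real.exp_eq_exp_ℝ, ← Real.exp_add] at h
  have e1 : -(2 * (μ : ℝ)) = -μ + -μ := by ring
  rw [e1]
  refine h.congr_fun fun n ↦ ?_
  rw [neg_pow (μ : ℝ)]
  ring

lemma integral_poissonMeasure_neg_one_pow (μ : ℝ≥0) :
    ∫ n : ℕ, (-1 : ℝ) ^ n ∂(poissonMeasure μ) = Real.exp (-(2 * μ)) := by
  rw [integral_poissonMeasure]
  exact (hasSum_poissonMeasure_neg_one_pow μ).tsum_eq

/-- The functions of the event count to be averaged depend only on its parity and on whether it
vanishes. -/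
lemma lintegral_poissonMeasure_parity (μ : ℝ≥0) (a b c : ℝ)
    (h : ∀ n : ℕ, 0 ≤ a + (if n = 0 then b else 0) + c * (-1) ^ n) :
    ∫⁻ n : ℕ, ENNReal.ofReal (a + (if n = 0 then b else 0) + c * (-1) ^ n) ∂(poissonMeasure μ) =
      ENNReal.ofReal (a + b * Real.exp (-μ) + c * Real.exp (-(2 * μ))) := by
  have hind : (fun n : ℕ ↦ if n = 0 then b else 0) = ({0} : Set ℕ).indicator fun _ ↦ b := by
    ext n; by_cases hn : n = 0 <;> simp [hn]
  have i1 : Integrable (fun n : ℕ ↦ if n = 0 then b else 0) (poissonMeasure μ) := by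
    rw [hind]; exact (integrable_const b).indicator (measurableSet_singleton 0)
  have i2 : Integrable (fun n : ℕ ↦ (-1 : ℝ) ^ n) (poissonMeasure μ) :=
    (integrable_const (1 : ℝ)).mono' .of_discrete (by simp)
  have i3 : Integrable (fun n : ℕ ↦ a + if n = 0 then b else 0) (poissonMeasure μ) :=
    (integrable_const a).add i1
  have h1 := ofReal_integral_eq_lintegral_ofReal (i3.add (i2.const_mul c)) (ae_of_all _ h)
  simp only [Pi.add_apply] at h1
  rw [← h1, integral_add i3 (i2.const_mul c), integral_add (integrable_const a) i1,
    integral_const_mul, integral_poissonMeasure_neg_one_pow, hind,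
    integral_indicator (measurableSet_singleton 0)]
  have h2 : (poissonMeasure μ).real {0} = Real.exp (-μ) := by simp [poissonMeasure_real_singleton]
  simp [← measureReal_def, h2, mul_comm]

/-- The probability that a telegraph sign paced by a Poisson variable of mean `μ / 2` is
multiplied by `ε = ±1`. -/
noncomputable def signProb (μ : ℝ) (ε : ℝ) : ℝ := (1 + ε * Real.exp (-μ)) / 2

lemma signProb_nonneg {μ ε : ℝ} (hμ : 0 ≤ μ) (hε : ε = 1 ∨ ε = -1) : 0 ≤ signProb μ ε := by
  have h1 := Real.exp_pos (-μ)
  have h2 : Real.exp (-μ) ≤ 1 := Real.exp_le_one_iff.2 (by linarith)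
  rcases hε with rfl | rfl <;> simp only [signProb] <;> linarith

lemma sumSign_eq_or (k : ZMod 4) : sumSign k = 1 ∨ sumSign k = -1 := by
  rw [sumSign]; split_ifs <;> simp

lemma diffSign_eq_or (k : ZMod 4) : diffSign k = 1 ∨ diffSign k = -1 := by
  rw [diffSign]; split_ifs <;> simp

/-- A fair walk with a Poisson number of steps factorizes into two independent sign changes, each
paced by a Poisson variable of half the mean. -/
lemma lintegral_walkProb (μ : ℝ≥0) (w : ZMod 4) :
    ∫⁻ n, ENNReal.ofReal (walkProb n w) ∂(poissonMeasure μ) =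
      ENNReal.ofReal (signProb μ (sumSign w) * signProb μ (diffSign w)) := by
  have h := lintegral_poissonMeasure_parity μ (1 / 4) ((sumSign w + diffSign w) / 4)
    (sumSign w * diffSign w / 4) ?_
  · convert h using 2
    · ext n
      congr 1
      rw [walkProb]
      split_ifs <;> ring
    · have : Real.exp (-(2 * μ)) = Real.exp (-μ) * Real.exp (-μ) := by
        rw [← Real.exp_add]; ring_nf
      rw [signProb, signProb, this]
      ring
  · intro n
    have := walkProb_nonneg n w
    rw [walkProb] at this
    convert this using 1
    split_ifs <;> ring

lemma poissonMeasure_neg_one_pow_eq (μ : ℝ≥0) {ε : ℝ} (hε : ε = 1 ∨ ε = -1) :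
    poissonMeasure μ {n | (-1 : ℝ) ^ n = ε} = ENNReal.ofReal (signProb (2 * μ) ε) := by
  have h := lintegral_poissonMeasure_parity μ (1 / 2) 0 (ε / 2) ?_
  · rw [← lintegral_indicator_one .of_discrete]
    convert h using 2
    · ext n
      by_cases hn : (-1 : ℝ) ^ n = ε
      · have h2 : ε * ε = 1 := by rcases hε with rfl | rfl <;> norm_num
        have h3 : (1 / 2 + ε / 2 * ε : ℝ) = 1 := by linarith
        have hmem : n ∈ {n : ℕ | (-1 : ℝ) ^ n = ε} := hn
        rw [indicator_of_mem hmem, hn, ite_self, add_zero, h3]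
        simp
      · have h2 : (-1 : ℝ) ^ n = -ε := by
          rcases neg_one_pow_eq_or ℝ n with h | h <;> rcases hε with rfl | rfl <;> simp_all
        have h3 : ε * ε = 1 := by rcases hε with rfl | rfl <;> norm_num
        have h4 : (1 / 2 + ε / 2 * -ε : ℝ) = 0 := by linarith
        rw [indicator_of_notMem (by exact hn), h2]
        rw [ite_self, add_zero, h4, ENNReal.ofReal_zero]
    · rw [signProb]; ring
  · intro n
    rcases neg_one_pow_eq_or ℝ n with h | h <;> rcases hε with rfl | rfl <;> rw [h] <;> norm_num

/-! ### Finite-dimensional laws -/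

/-- The probability of an event about two independent variables, computed by fixing the second
one. -/
lemma measure_prodMk_mem_of_indepFun {Ω α β : Type*} [MeasurableSpace Ω] [MeasurableSpace α]
    [MeasurableSpace β] {P : Measure Ω} [IsFiniteMeasure P] {f : Ω → α} {g : Ω → β}
    (hfg : IndepFun f g P) (hf : Measurable f) (hg : Measurable g) {s : Set (α × β)}
    (hs : MeasurableSet s) :
    P {ω | (f ω, g ω) ∈ s} = ∫⁻ ω, P {ω' | (f ω', g ω) ∈ s} ∂P := by
  have h1 : P {ω | (f ω, g ω) ∈ s} = P.map (fun ω ↦ (f ω, g ω)) s :=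
    (Measure.map_apply (hf.prodMk hg) hs).symm
  rw [h1, (indepFun_iff_map_prod_eq_prod_map_map hf.aemeasurable hg.aemeasurable).1 hfg,
    Measure.prod_apply_symm hs, lintegral_map (measurable_measure_prodMk_right hs) hg]
  refine lintegral_congr fun ω ↦ ?_
  rw [Measure.map_apply hf (measurable_prodMk_right hs)]
  rfl

section

variable {Ω : Type*} [MeasurableSpace Ω] {P : Measure Ω} {rate : ℝ → ℝ} {T : Ω → Set ℝ}

lemma IsPoissonEvents.measurable_counts (hT : IsPoissonEvents rate T P) {s : ℝ} (hs : 0 < s) :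
    Measurable fun ω (t : ℝ) ↦ eventCount T s t ω :=
  measurable_pi_lambda _ fun t ↦ hT.measurable s t hs

lemma IsPoissonEvents.measure_eventCount (hT : IsPoissonEvents rate T P) {s t : ℝ} (hs : 0 < s)
    (hst : s ≤ t) (A : Set ℕ) :
    P {ω | eventCount T s t ω ∈ A} = poissonMeasure (∫ r in s..t, rate r).toNNReal A := by
  rw [← (hT.hasLaw s t hs hst).map_eq, Measure.map_apply (hT.measurable s t hs) .of_discrete]
  rfl

/-- The telegraph sign is a Markov chain along finitely many times: its path probabilities are
products of the probabilities `signProb` that the sign is kept or reversed over an interval. -/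
lemma IsTelegraphSign.measure_path {S : ℝ → Ω → ℝ} (hS : IsTelegraphSign rate T S P) {t : ℕ → ℝ}
    (ht : Monotone t) (h0 : 0 < t 0) (m : ℕ) {a : ℕ → ℝ} (ha : ∀ i, a i = 1 ∨ a i = -1) :
    P {ω | ∀ i ≤ m, S (t i) ω = a i} = 1 / 2 * ∏ j ∈ Finset.range m,
      ENNReal.ofReal (signProb (2 * (∫ r in t j..t (j + 1), rate r).toNNReal)
        (a j * a (j + 1))) := by
  have hpos : ∀ i, 0 < t i := fun i ↦ h0.trans_le (ht (Nat.zero_le i))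
  have hset : {ω | ∀ i ≤ m, S (t i) ω = a i} = (S (t 0)) ⁻¹' {a 0} ∩
      (fun ω (u : ℝ) ↦ eventCount T (t 0) u ω) ⁻¹'
        {ν | ∀ j ∈ Finset.range m, (-1 : ℝ) ^ (ν (t (j + 1)) - ν (t j)) = a j * a (j + 1)} := by
    ext ω
    have hstep : ∀ j, S (t (j + 1)) ω = S (t j) ω *
        (-1) ^ (eventCount T (t 0) (t (j + 1)) ω - eventCount T (t 0) (t j) ω) := fun j ↦ by
      rw [eventCount_add (hS.events.finite ω) h0 (ht (Nat.zero_le j)) (ht j.le_succ),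
        Nat.add_sub_cancel_left]
      exact hS.switch _ _ (hpos j) (ht j.le_succ) ω
    simp only [mem_ofPred_eq, mem_inter_iff, mem_preimage, mem_singleton_iff, Finset.mem_range]
    have hsq : ∀ i, a i * a i = 1 := fun i ↦ by rcases ha i with h | h <;> rw [h] <;> norm_num
    constructor
    · intro h
      refine ⟨h 0 (Nat.zero_le m), fun j hj ↦ ?_⟩
      rw [← h (j + 1) hj, hstep j, h j hj.le, ← mul_assoc, hsq, one_mul]
    · rintro ⟨h, h'⟩ i
      induction i with
      | zero => exact fun _ ↦ h
      | succ i ih => intro hi; rw [hstep, ih (by lia), h' i hi, ← mul_assoc, hsq, one_mul]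
  have hmeas : MeasurableSet {ν : ℝ → ℕ | ∀ j ∈ Finset.range m,
      (-1 : ℝ) ^ (ν (t (j + 1)) - ν (t j)) = a j * a (j + 1)} := by
    simp only [ofPred_forall]
    refine Finset.measurableSet_biInter _ fun j _ ↦ ?_
    have hev : ∀ u, Measurable fun ν : ℝ → ℕ ↦ ν u := fun u ↦ measurable_pi_apply u
    have : Measurable fun ν : ℝ → ℕ ↦ (-1 : ℝ) ^ (ν (t (j + 1)) - ν (t j)) :=
      (Measurable.of_discrete (f := fun q : ℕ × ℕ ↦ (-1 : ℝ) ^ (q.1 - q.2))).comp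
        ((hev (t (j + 1))).prodMk (hev (t j)))
    exact this (measurableSet_singleton _)
  have hhalf : P (S (t 0) ⁻¹' {a 0}) = 1 / 2 := by
    rcases ha 0 with h | h <;> rw [h]
    exacts [(hS.uniform _ h0).1, (hS.uniform _ h0).2]
  rw [hset, (hS.indep _ h0).measure_inter_preimage_eq_mul _ _ (measurableSet_singleton _) hmeas,
    hhalf]
  congr 1
  have hset2 : (fun ω (u : ℝ) ↦ eventCount T (t 0) u ω) ⁻¹'
        {ν | ∀ j ∈ Finset.range m, (-1 : ℝ) ^ (ν (t (j + 1)) - ν (t j)) = a j * a (j + 1)} =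
      ⋂ j ∈ Finset.range m, (fun ω ↦ eventCount T (t j) (t (j + 1)) ω) ⁻¹'
        {n | (-1 : ℝ) ^ n = a j * a (j + 1)} := by
    ext ω
    simp only [mem_preimage, mem_ofPred_eq, mem_iInter]
    refine forall₂_congr fun j _ ↦ ?_
    rw [eventCount_add (hS.events.finite ω) h0 (ht (Nat.zero_le j)) (ht j.le_succ),
        Nat.add_sub_cancel_left]
  rw [hset2, (hS.events.indep t ht h0).measure_inter_preimage_eq_mul _ fun _ _ ↦ .of_discrete]
  refine Finset.prod_congr rfl fun j _ ↦ ?_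
  rw [← poissonMeasure_neg_one_pow_eq]
  · exact hS.events.measure_eventCount (hpos j) (ht j.le_succ) _
  · rcases ha j with h | h <;> rcases ha (j + 1) with h' | h' <;> rw [h, h'] <;> norm_num

/-- Moving from the direction `k` to `l` by the index `l - k` changes the two signs by the signs
of `l - k`, in an order that depends on `k`. -/
lemma sumSign_sub_diffSign_sub (k l : ZMod 4) :
    (sumSign (l - k) = sumSign k * sumSign l ∧ diffSign (l - k) = diffSign k * diffSign l) ∨
    (sumSign (l - k) = diffSign k * diffSign l ∧ diffSign (l - k) = sumSign k * sumSign l) := by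
  have e1 : (0 : ZMod 4) - 1 = 3 := by decide
  have e2 : (0 : ZMod 4) - 2 = 2 := by decide
  have e3 : (0 : ZMod 4) - 3 = 1 := by decide
  have e4 : (1 : ZMod 4) - 2 = 3 := by decide
  have e5 : (1 : ZMod 4) - 3 = 2 := by decide
  have e6 : (2 : ZMod 4) - 1 = 1 := by decide
  have e7 : (2 : ZMod 4) - 3 = 3 := by decide
  have e8 : (3 : ZMod 4) - 1 = 2 := by decide
  have e9 : (3 : ZMod 4) - 2 = 1 := by decide
  rcases ZMod.four_cases k with rfl | rfl | rfl | rfl <;>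
  rcases ZMod.four_cases l with rfl | rfl | rfl | rfl <;>
  simp only [sub_self, sub_zero, e1, e2, e3, e4, e5, e6, e7, e8, e9, sumSign_zero, sumSign_one,
    sumSign_two, sumSign_three, diffSign_zero, diffSign_one, diffSign_two, diffSign_three] <;>
  norm_num

/-- The path probabilities of the direction process are those of two independent telegraph signs:
given the event counts, the increments of the index are block sums of a fair walk, and averaging
over the Poisson counts splits each factor by `lintegral_walkProb`. -/
lemma IsOrthogonalDirectionProcess.measure_path [IsProbabilityMeasure P] {D : ℝ → Ω → ZMod 4}
    (hD : IsOrthogonalDirectionProcess rate T D P) {t : ℕ → ℝ}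
    (ht : Monotone t) (h0 : 0 < t 0) (m : ℕ) (k : ℕ → ZMod 4) :
    P {ω | ∀ i ≤ m, D (t i) ω = k i} = 1 / 4 * ∏ j ∈ Finset.range m, ENNReal.ofReal
      (signProb (∫ r in t j..t (j + 1), rate r).toNNReal (sumSign (k j) * sumSign (k (j + 1))) *
       signProb (∫ r in t j..t (j + 1), rate r).toNNReal
        (diffSign (k j) * diffSign (k (j + 1)))) := by
  have hpos : ∀ i, 0 < t i := fun i ↦ h0.trans_le (ht (Nat.zero_le i))
  obtain ⟨ξ, hm, hfair, hi, hξN, hDξ, hsw⟩ := hD.switch (t 0) h0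
  set N : Ω → ℝ → ℕ := fun ω u ↦ eventCount T (t 0) u ω with hN
  let w : ℕ → ZMod 4 := fun j ↦ k (j + 1) - k j
  let B : Set ((ℕ → ZMod 4) × (ℝ → ℕ)) := {q | ∀ j ∈ Finset.range m,
    ∑ i ∈ Finset.Ico (q.2 (t j)) (q.2 (t (j + 1))), q.1 i = w j}
  have hB : MeasurableSet B := by
    simp only [B, ofPred_forall]
    refine Finset.measurableSet_biInter _ fun j _ ↦ ?_
    have hev : ∀ i, Measurable fun x : ℕ → ZMod 4 ↦ x i := fun i ↦ measurable_pi_apply i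
    have h1 : Measurable fun q : (ℕ → ZMod 4) × (ℕ × ℕ) ↦
        ∑ i ∈ Finset.Ico q.2.1 q.2.2, q.1 i := by
      refine measurable_from_prod_countable_left fun y ↦ ?_
      exact Finset.measurable_sum (Finset.Ico y.1 y.2) fun i _ ↦ hev i
    have h2 : Measurable fun q : (ℕ → ZMod 4) × (ℝ → ℕ) ↦
        (q.1, (q.2 (t j), q.2 (t (j + 1)))) :=
      measurable_fst.prodMk (((measurable_pi_apply _).comp measurable_snd).prodMk
        ((measurable_pi_apply _).comp measurable_snd))
    exact (h1.comp h2) (measurableSet_singleton (w j))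
  have hNmono : ∀ ω j, N ω (t j) ≤ N ω (t (j + 1)) := fun ω j ↦ by
    simp only [hN]
    rw [eventCount_add (hD.events.finite ω) h0 (ht (Nat.zero_le j)) (ht j.le_succ)]
    exact Nat.le_add_right _ _
  have hset : {ω | ∀ i ≤ m, D (t i) ω = k i} = D (t 0) ⁻¹' {k 0} ∩
      (fun ω ↦ ((fun i ↦ ξ i ω), N ω)) ⁻¹' B := by
    ext ω
    have hstep : ∀ j, D (t (j + 1)) ω = D (t j) ω +
        ∑ i ∈ Finset.Ico (N ω (t j)) (N ω (t (j + 1))), ξ i ω := fun j ↦ by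
      rw [hsw _ (ht (Nat.zero_le _)), hsw _ (ht (Nat.zero_le j)), add_assoc,
        Finset.sum_range_add_sum_Ico _ (hNmono ω j)]
    simp only [mem_ofPred_eq, mem_inter_iff, mem_preimage, mem_singleton_iff, Finset.mem_range, B,
      w]
    constructor
    · intro h
      refine ⟨h 0 (Nat.zero_le m), fun j hj ↦ ?_⟩
      rw [← h (j + 1) hj, ← h j hj.le, hstep j, add_sub_cancel_left]
    · rintro ⟨h, h'⟩ i
      induction i with
      | zero => exact fun _ ↦ h
      | succ i ih => intro hi; rw [hstep, ih (by lia), h' i hi, add_sub_cancel]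
  have hmξ : Measurable fun ω k ↦ ξ k ω := measurable_pi_lambda _ hm
  have hmN : Measurable N := hD.events.measurable_counts h0
  rw [hset, hDξ.measure_inter_preimage_eq_mul _ _ (measurableSet_singleton _) hB]
  congr 1
  · exact hD.uniform _ h0 _
  -- condition on the event counts
  change P {ω | ((fun i ↦ ξ i ω), N ω) ∈ B} = _
  rw [measure_prodMk_mem_of_indepFun hξN hmξ hmN hB]
  have hinner : ∀ ω, P {ω' | ((fun i ↦ ξ i ω'), N ω) ∈ B} = ∏ j ∈ Finset.range m,
      ENNReal.ofReal (walkProb (eventCount T (t j) (t (j + 1)) ω) (w j)) := by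
    intro ω
    have h := measureReal_blocks hm hfair hi (fun j ↦ eventCount T (t j) (t (j + 1)) ω) w m
    rw [← ENNReal.ofReal_prod_of_nonneg fun j _ ↦ walkProb_nonneg _ _, ← h, ofReal_measureReal]
    congr 1
    ext ω'
    simp only [B, mem_ofPred_eq, Finset.mem_range]
    refine forall₂_congr fun j _ ↦ ?_
    have hNj : ∀ j, N ω (t j) = ∑ i ∈ Finset.range j, eventCount T (t i) (t (i + 1)) ω := fun j ↦ by
      simp only [hN]
      rw [eventCount_eq_sum (hD.events.finite ω) ht h0 (Nat.zero_le j), Finset.range_eq_Ico]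
    rw [hNj, hNj]
  simp only [hinner]
  have hprod := lintegral_prod_eq_prod_lintegral_of_indepFun (Finset.range m)
    (fun j ω ↦ ENNReal.ofReal (walkProb (eventCount T (t j) (t (j + 1)) ω) (w j)))
    ((hD.events.indep t ht h0).comp (fun j n ↦ ENNReal.ofReal (walkProb n (w j)))
      fun _ ↦ .of_discrete)
    (fun j ↦ (Measurable.of_discrete (f := fun n ↦ ENNReal.ofReal (walkProb n (w j)))).comp
      (hD.events.measurable _ _ (hpos j)))
  rw [hprod]
  refine Finset.prod_congr rfl fun j _ ↦ ?_
  have hl := (hD.events.hasLaw _ _ (hpos j) (ht (Nat.le_add_right j 1))).map_eq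
  have := lintegral_walkProb (∫ r in t j..t (j + 1), rate r).toNNReal (w j)
  rw [← hl, lintegral_map .of_discrete (hD.events.measurable _ _ (hpos j))] at this
  rw [this]
  rcases sumSign_sub_diffSign_sub (k j) (k (j + 1)) with ⟨h1, h2⟩ | ⟨h1, h2⟩
  · rw [h1, h2]
  · rw [h1, h2, mul_comm]

end

/-! ### From finite-dimensional laws to laws of processes -/

/-- Finitely many positive times are among the first terms of a monotone sequence of positive
times. -/
lemma exists_monotone_enumeration (I : Finset ℝ) (hI : ∀ r ∈ I, 0 < r) :
    ∃ t : ℕ → ℝ, Monotone t ∧ 0 < t 0 ∧ ∃ m, ∀ r ∈ I, ∃ i ≤ m, t i = r := by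
  induction I using Finset.induction_on_max with
  | empty => exact ⟨fun _ ↦ 1, monotone_const, one_pos, 0, by simp⟩
  | insert a s hs ih =>
    obtain ⟨t, ht, h0, m, hm⟩ := ih fun r hr ↦ hI r (Finset.mem_insert_of_mem hr)
    refine ⟨fun i ↦ if i ≤ m then min (t i) a else a, fun i j hij ↦ ?_, ?_, m + 1, fun r hr ↦ ?_⟩
    · dsimp only
      split_ifs with h1 h2 h2
      · exact min_le_min_right _ (ht hij)
      · exact min_le_right _ _
      · lia
      · exact le_rfl
    · simpa using ⟨h0, hI a (Finset.mem_insert_self a s)⟩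
    · rcases Finset.mem_insert.1 hr with rfl | hr
      · exact ⟨m + 1, le_rfl, by simp⟩
      · obtain ⟨i, hi, rfl⟩ := hm r hr
        exact ⟨i, by lia, by simp [hi, (hs _ hr).le]⟩

lemma preimage_singleton_eq_forall_le {Ω E : Type*} [Zero E] {m : ℕ} (D : ℕ → Ω → E)
    (y : Fin (m + 1) → E) : (fun ω (i : Fin (m + 1)) ↦ D i ω) ⁻¹' {y} =
      {ω | ∀ i ≤ m, D i ω = if hi : i < m + 1 then y ⟨i, hi⟩ else 0} := by
  ext ω
  simp only [mem_preimage, mem_singleton_iff, funext_iff, mem_ofPred_eq]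
  exact ⟨fun h i hi ↦ by rw [dif_pos (Nat.lt_succ_of_le hi)]; exact h ⟨i, Nat.lt_succ_of_le hi⟩,
    fun h i ↦ by rw [h i (Nat.le_of_lt_succ i.2), dif_pos i.2]⟩

/-- A process with values in the four directions is determined in law by the probabilities of its
positions at finitely many increasing times. -/
lemma map_process_eq_of_measure_path_eq {Ω Ω' : Type*} [MeasurableSpace Ω] [MeasurableSpace Ω']
    {P : Measure Ω} [IsFiniteMeasure P] {P' : Measure Ω'} [IsFiniteMeasure P']
    {D : ℝ → Ω → ZMod 4} {D' : ℝ → Ω' → ZMod 4} (hD : ∀ r, 0 < r → Measurable (D r))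
    (hD' : ∀ r, 0 < r → Measurable (D' r))
    (h : ∀ t : ℕ → ℝ, Monotone t → 0 < t 0 → ∀ (m : ℕ) (k : ℕ → ZMod 4),
      P {ω | ∀ i ≤ m, D (t i) ω = k i} = P' {ω | ∀ i ≤ m, D' (t i) ω = k i}) :
    P.map (fun ω (r : Ioi (0 : ℝ)) ↦ D r ω) = P'.map (fun ω (r : Ioi (0 : ℝ)) ↦ D' r ω) := by
  have hm : Measurable fun ω (r : Ioi (0 : ℝ)) ↦ D r ω := measurable_pi_lambda _ fun r ↦ hD r r.2
  have hm' : Measurable fun ω (r : Ioi (0 : ℝ)) ↦ D' r ω :=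
    measurable_pi_lambda _ fun r ↦ hD' r r.2
  have h1 := isProjectiveLimit_map (P := P) (X := fun (r : Ioi (0 : ℝ)) ω ↦ D r ω) hm.aemeasurable
  have h2 := isProjectiveLimit_map (P := P') (X := fun (r : Ioi (0 : ℝ)) ω ↦ D' r ω)
    hm'.aemeasurable
  refine h1.unique (fun I ↦ (h2 I).trans ?_)
  obtain ⟨t, ht, h0, m, hI⟩ := exists_monotone_enumeration (I.image Subtype.val)
    (by simp +contextual)
  have hpos : ∀ i, 0 < t i := fun i ↦ h0.trans_le (ht (Nat.zero_le i))
  choose! idx hidx hidx' using fun r : Ioi (0 : ℝ) ↦ fun hr : r ∈ I ↦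
    hI r (Finset.mem_image_of_mem _ hr)
  let g : (Fin (m + 1) → ZMod 4) → I → ZMod 4 := fun y r ↦ y ⟨idx r, by
    have := hidx r r.2
    lia⟩
  have e1 : (fun ω ↦ I.restrict fun r : Ioi (0 : ℝ) ↦ D r ω) =
      g ∘ fun ω (i : Fin (m + 1)) ↦ D (t i) ω := by
    ext ω r
    simp [g, hidx' r r.2]
  have e2 : (fun ω ↦ I.restrict fun r : Ioi (0 : ℝ) ↦ D' r ω) =
      g ∘ fun ω (i : Fin (m + 1)) ↦ D' (t i) ω := by
    ext ω r
    simp [g, hidx' r r.2]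
  have hm1 : Measurable fun ω (i : Fin (m + 1)) ↦ D (t i) ω :=
    measurable_pi_lambda _ fun i ↦ hD _ (hpos i)
  have hm2 : Measurable fun ω (i : Fin (m + 1)) ↦ D' (t i) ω :=
    measurable_pi_lambda _ fun i ↦ hD' _ (hpos i)
  have hg : Measurable g := .of_discrete
  simp only
  rw [e1, e2, ← Measure.map_map hg hm1, ← Measure.map_map hg hm2]
  congr 1
  refine Measure.ext_of_singleton fun y ↦ ?_
  rw [Measure.map_apply hm2 (measurableSet_singleton y),
    Measure.map_apply hm1 (measurableSet_singleton y)]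
  have hk := h t ht h0 m fun i ↦ if hi : i < m + 1 then y ⟨i, hi⟩ else 0
  rw [preimage_singleton_eq_forall_le fun i ↦ D (t i), hk,
    preimage_singleton_eq_forall_le fun i ↦ D' (t i)]

/-- The direction in which the signs of `x + y` and `x - y` are `a` and `b`. -/
noncomputable def directionOfSigns (a b : ℝ) : ZMod 4 :=
  if a = 1 then (if b = 1 then 0 else 1) else (if b = 1 then 3 else 2)

lemma directionOfSigns_eq_iff {a b : ℝ} (ha : a = 1 ∨ a = -1) (hb : b = 1 ∨ b = -1) (k : ZMod 4) :
    directionOfSigns a b = k ↔ a = sumSign k ∧ b = diffSign k := by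
  have h : (-1 : ℝ) ≠ 1 := by norm_num
  have h01 : (0 : ZMod 4) ≠ 1 := by decide
  rcases ZMod.four_cases k with rfl | rfl | rfl | rfl <;> rcases ha with rfl | rfl <;>
  rcases hb with rfl | rfl <;>
  simp only [directionOfSigns, sumSign_zero, sumSign_one, sumSign_two, sumSign_three,
    diffSign_zero, diffSign_one, diffSign_two, diffSign_three, h, h.symm, if_true, if_false,
    and_true, and_false, iff_false] <;>
  decide

lemma measurable_directionOfSigns : Measurable fun p : ℝ × ℝ ↦ directionOfSigns p.1 p.2 := by
  have h1 : MeasurableSet {p : ℝ × ℝ | p.1 = 1} := measurable_fst (measurableSet_singleton 1)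
  have h2 : MeasurableSet {p : ℝ × ℝ | p.2 = 1} := measurable_snd (measurableSet_singleton 1)
  exact Measurable.ite h1 (Measurable.ite h2 measurable_const measurable_const)
    (Measurable.ite h2 measurable_const measurable_const)

lemma orthogonalDirection_fst (k : ZMod 4) :
    (orthogonalDirection k).1 = (sumSign k + diffSign k) / 2 := by
  have v2 : (2 : ZMod 4).val = 2 := rfl
  have v3 : (3 : ZMod 4).val = 3 := rfl
  have v1 : (1 : ZMod 4).val = 1 := rfl
  have a2 : (2 : ℝ) * Real.pi / 2 = Real.pi := by ring
  have a3 : (3 : ℝ) * Real.pi / 2 = Real.pi / 2 + Real.pi := by ring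
  rcases ZMod.four_cases k with rfl | rfl | rfl | rfl <;>
  simp [orthogonalDirection, v1, v2, v3, a2, a3, Real.cos_add_pi, sumSign_zero, sumSign_one,
    sumSign_two, sumSign_three, diffSign_zero, diffSign_one, diffSign_two, diffSign_three]

lemma orthogonalDirection_snd (k : ZMod 4) :
    (orthogonalDirection k).2 = (sumSign k - diffSign k) / 2 := by
  have v2 : (2 : ZMod 4).val = 2 := rfl
  have v3 : (3 : ZMod 4).val = 3 := rfl
  have v1 : (1 : ZMod 4).val = 1 := rfl
  have a2 : (2 : ℝ) * Real.pi / 2 = Real.pi := by ring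
  have a3 : (3 : ℝ) * Real.pi / 2 = Real.pi / 2 + Real.pi := by ring
  rcases ZMod.four_cases k with rfl | rfl | rfl | rfl <;>
  simp [orthogonalDirection, v1, v2, v3, a2, a3, Real.sin_add_pi, sumSign_zero, sumSign_one,
    sumSign_two, sumSign_three, diffSign_zero, diffSign_one, diffSign_two, diffSign_three]
  norm_num

section

variable {Ω Ω' : Type*} [MeasurableSpace Ω] [MeasurableSpace Ω'] {P : Measure Ω} {P' : Measure Ω'}
  {rate : ℝ → ℝ}

lemma IsTelegraphSign.rightConstant {T : Ω → Set ℝ} {S : ℝ → Ω → ℝ}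
    (hS : IsTelegraphSign rate T S P) (ω : Ω) : RightConstant fun r ↦ S r ω := by
  intro r hr
  filter_upwards [eventually_eventCount_eq_zero (hS.events.finite ω) hr, self_mem_nhdsWithin]
    with s hs hrs
  rw [hS.switch r s hr (le_of_lt hrs), hs, pow_zero, mul_one]

lemma IsOrthogonalDirectionProcess.rightConstant {T : Ω → Set ℝ} {D : ℝ → Ω → ZMod 4}
    (hD : IsOrthogonalDirectionProcess rate T D P) (ω : Ω) : RightConstant fun r ↦ D r ω := by
  intro r hr
  obtain ⟨ξ, -, -, -, -, -, h⟩ := hD.switch r hr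
  filter_upwards [eventually_eventCount_eq_zero (hD.events.finite ω) hr, self_mem_nhdsWithin]
    with s hs hrs
  rw [h s (le_of_lt hrs), hs, Finset.range_zero, Finset.sum_empty, add_zero]

lemma IsTelegraphSign.abs_le {T : Ω → Set ℝ} {S : ℝ → Ω → ℝ}
    (hS : IsTelegraphSign rate T S P) (v : ℝ) (ω : Ω) (r : ℝ) (hr : 0 < r) :
    |v * S r ω| ≤ |v| := by
  rcases hS.sign r hr ω with h | h <;> simp [h]

lemma IsTelegraphSign.intervalIntegrable {T : Ω → Set ℝ} {S : ℝ → Ω → ℝ}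
    (hS : IsTelegraphSign rate T S P) (v : ℝ) (ω : Ω) {s t : ℝ} (hs : 0 ≤ s) (ht : 0 ≤ t) :
    IntervalIntegrable (fun r ↦ v * S r ω) volume s t :=
  (hS.rightConstant ω).intervalIntegrable (h := fun x ↦ v * x) (measurable_id.const_mul v)
    (hS.abs_le v ω) hs ht

lemma IsTelegraphSign.pathIntegral_eq {T : Ω → Set ℝ} {S : ℝ → Ω → ℝ}
    (hS : IsTelegraphSign rate T S P) (v : ℝ) (ω : Ω) {t : ℝ} (ht : 0 ≤ t) :
    pathIntegral (fun x ↦ v * x) (fun r ↦ S r ω) t = ∫ r in (0 : ℝ)..t, v * S r ω :=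
  (hS.rightConstant ω).pathIntegral_eq (measurable_id.const_mul v) (hS.abs_le v ω) ht

lemma IsTelegraphProcess.measurable {v : ℝ} {U : ℝ≥0 → Ω → ℝ}
    (hU : IsTelegraphProcess v rate U P) (t : ℝ≥0) : Measurable (U t) := by
  obtain ⟨T, S, hS, hUS⟩ := hU
  have h1 : Measurable fun ω (r : Ioi (0 : ℝ)) ↦ S r ω :=
    measurable_pi_lambda _ fun r ↦ hS.measurable r r.2
  have h2 : U t = (fun d ↦ pathIntegral (fun x ↦ v * x) d t) ∘ fun ω (r : Ioi (0 : ℝ)) ↦ S r ω := by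
    ext ω
    exact (hUS t ω).trans (hS.pathIntegral_eq v ω t.coe_nonneg).symm
  rw [h2]
  exact (measurable_pathIntegral (measurable_id.const_mul v) t).comp h1

/-- The law of the direction process is that of the direction whose signs of `x + y` and `x - y`
are independent telegraph signs of half the rate. The signs are taken on the product space: the
processes `U` and `V` are independent, but nothing is assumed about the joint law of their
signs. -/
lemma IsOrthogonalDirectionProcess.map_eq_map_directionOfSigns [IsProbabilityMeasure P]
    [IsProbabilityMeasure P'] {T : Ω → Set ℝ} {D : ℝ → Ω → ZMod 4} {T₁ T₂ : Ω' → Set ℝ}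
    {S₁ S₂ : ℝ → Ω' → ℝ} (hD : IsOrthogonalDirectionProcess rate T D P)
    (h₁ : IsTelegraphSign (fun t ↦ rate t / 2) T₁ S₁ P')
    (h₂ : IsTelegraphSign (fun t ↦ rate t / 2) T₂ S₂ P') :
    P.map (fun ω (r : Ioi (0 : ℝ)) ↦ D r ω) =
      (P'.prod P').map (fun (ω : Ω' × Ω') (r : Ioi (0 : ℝ)) ↦
        directionOfSigns (S₁ r ω.1) (S₂ r ω.2)) := by
  refine map_process_eq_of_measure_path_eq
    (D' := fun r (ω : Ω' × Ω') ↦ directionOfSigns (S₁ r ω.1) (S₂ r ω.2))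
    hD.measurable (fun r hr ↦ ?_) fun t ht h0 m k ↦ ?_
  · exact measurable_directionOfSigns.comp (((h₁.measurable r hr).comp measurable_fst).prodMk
      ((h₂.measurable r hr).comp measurable_snd))
  · have hpos : ∀ i, 0 < t i := fun i ↦ h0.trans_le (ht (Nat.zero_le i))
    have hset : {ω : Ω' × Ω' | ∀ i ≤ m, directionOfSigns (S₁ (t i) ω.1) (S₂ (t i) ω.2) = k i} =
        {ω | ∀ i ≤ m, S₁ (t i) ω = sumSign (k i)} ×ˢ
          {ω | ∀ i ≤ m, S₂ (t i) ω = diffSign (k i)} := by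
      ext ω
      simp only [mem_ofPred_eq, mem_prod]
      simp only [directionOfSigns_eq_iff (h₁.sign _ (hpos _) _) (h₂.sign _ (hpos _) _)]
      exact ⟨fun h ↦ ⟨fun i hi ↦ (h i hi).1, fun i hi ↦ (h i hi).2⟩,
        fun h i hi ↦ ⟨h.1 i hi, h.2 i hi⟩⟩
    rw [hset, Measure.prod_prod, hD.measure_path ht h0,
      h₁.measure_path ht h0 m (a := fun i ↦ sumSign (k i)) fun i ↦ sumSign_eq_or _,
      h₂.measure_path ht h0 m (a := fun i ↦ diffSign (k i)) fun i ↦ diffSign_eq_or _,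
      mul_mul_mul_comm, ← Finset.prod_mul_distrib]
    congr 1
    · rw [one_div, one_div, ← ENNReal.mul_inv (by simp) (by simp)]; norm_num
    refine Finset.prod_congr rfl fun j _ ↦ ?_
    have hmean : (2 : ℝ) * (∫ r in t j..t (j + 1), rate r / 2).toNNReal =
        (∫ r in t j..t (j + 1), rate r).toNNReal := by
      rw [intervalIntegral.integral_div, Real.coe_toNNReal', Real.coe_toNNReal',
        mul_max_of_nonneg _ _ zero_le_two]
      congr 1 <;> ring
    have hsign : ∀ {x y : ℝ}, (x = 1 ∨ x = -1) → (y = 1 ∨ y = -1) → x * y = 1 ∨ x * y = -1 := by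
      rintro x y (rfl | rfl) (rfl | rfl) <;> norm_num
    simp only [hmean]
    rw [ENNReal.ofReal_mul]
    exact signProb_nonneg NNReal.zero_le_coe (hsign (sumSign_eq_or _) (sumSign_eq_or _))

lemma abs_mul_orthogonalDirection_le (c : ℝ) (k : ZMod 4) :
    |c * (orthogonalDirection k).1| ≤ |c| ∧ |c * (orthogonalDirection k).2| ≤ |c| := by
  simp only [abs_mul, orthogonalDirection]
  exact ⟨mul_le_of_le_one_right (abs_nonneg c) (Real.abs_cos_le_one _),
    mul_le_of_le_one_right (abs_nonneg c) (Real.abs_sin_le_one _)⟩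

/-- Both processes are the same measurable functional of direction processes with equal laws. -/
theorem IsStandardOrthogonalMotion.identDistrib [IsProbabilityMeasure P]
    [IsProbabilityMeasure P'] {c : ℝ} {X Y : ℝ≥0 → Ω → ℝ}
    (hXY : IsStandardOrthogonalMotion c rate X Y P) {U V : ℝ≥0 → Ω' → ℝ}
    (hU : IsTelegraphProcess (c / 2) (fun t ↦ rate t / 2) U P')
    (hV : IsTelegraphProcess (c / 2) (fun t ↦ rate t / 2) V P')
    (hUV : IndepFun (fun ω (t : ℝ≥0) ↦ U t ω) (fun ω (t : ℝ≥0) ↦ V t ω) P') :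
    IdentDistrib (fun ω (t : ℝ≥0) ↦ (X t ω, Y t ω))
      (fun ω (t : ℝ≥0) ↦ (U t ω + V t ω, U t ω - V t ω)) P P' := by
  have hUm : Measurable fun ω (t : ℝ≥0) ↦ U t ω := measurable_pi_lambda _ hU.measurable
  have hVm : Measurable fun ω (t : ℝ≥0) ↦ V t ω := measurable_pi_lambda _ hV.measurable
  obtain ⟨T, D, hD, hXY⟩ := hXY
  obtain ⟨T₁, S₁, h₁, hU⟩ := hU
  obtain ⟨T₂, S₂, h₂, hV⟩ := hV
  have hlaw := hD.map_eq_map_directionOfSigns h₁ h₂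
  let Ψ : (Ioi (0 : ℝ) → ZMod 4) → ℝ≥0 → ℝ × ℝ := fun d t ↦
    (pathIntegral (fun k ↦ c * (orthogonalDirection k).1) d t,
      pathIntegral (fun k ↦ c * (orthogonalDirection k).2) d t)
  have hΨ : Measurable Ψ := measurable_pi_lambda _ fun t ↦
    (measurable_pathIntegral .of_discrete _).prodMk (measurable_pathIntegral .of_discrete _)
  have hDm : Measurable fun ω (r : Ioi (0 : ℝ)) ↦ D r ω :=
    measurable_pi_lambda _ fun r ↦ hD.measurable r r.2
  have hSm : Measurable fun (ω : Ω' × Ω') (r : Ioi (0 : ℝ)) ↦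
      directionOfSigns (S₁ r ω.1) (S₂ r ω.2) :=
    measurable_pi_lambda _ fun r ↦
      measurable_directionOfSigns.comp (((h₁.measurable r r.2).comp measurable_fst).prodMk
      ((h₂.measurable r r.2).comp measurable_snd))
  have e1 : (fun ω (t : ℝ≥0) ↦ (X t ω, Y t ω)) = Ψ ∘ fun ω (r : Ioi (0 : ℝ)) ↦ D r ω := by
    ext ω t
    · have h := (hD.rightConstant ω).pathIntegral_eq
        (h := fun k ↦ c * (orthogonalDirection k).1) .of_discrete
        (fun r _ ↦ (abs_mul_orthogonalDirection_le c (D r ω)).1) t.coe_nonneg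
      exact (hXY t ω).1.trans h.symm
    · have h := (hD.rightConstant ω).pathIntegral_eq
        (h := fun k ↦ c * (orthogonalDirection k).2) .of_discrete
        (fun r _ ↦ (abs_mul_orthogonalDirection_le c (D r ω)).2) t.coe_nonneg
      exact (hXY t ω).2.trans h.symm
  have e2 : (fun (ω : Ω' × Ω') (t : ℝ≥0) ↦ (U t ω.1 + V t ω.2, U t ω.1 - V t ω.2)) =
      Ψ ∘ fun (ω : Ω' × Ω') (r : Ioi (0 : ℝ)) ↦ directionOfSigns (S₁ r ω.1) (S₂ r ω.2) := by
    have hrc : ∀ ω : Ω' × Ω', RightConstant fun r ↦ directionOfSigns (S₁ r ω.1) (S₂ r ω.2) := by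
      intro ω r hr
      filter_upwards [h₁.rightConstant ω.1 r hr, h₂.rightConstant ω.2 r hr] with s hs hs'
      rw [hs, hs']
    have hsigns : ∀ (ω : Ω' × Ω') (r : ℝ), 0 < r →
        S₁ r ω.1 = sumSign (directionOfSigns (S₁ r ω.1) (S₂ r ω.2)) ∧
          S₂ r ω.2 = diffSign (directionOfSigns (S₁ r ω.1) (S₂ r ω.2)) := fun ω r hr ↦
      (directionOfSigns_eq_iff (h₁.sign r hr ω.1) (h₂.sign r hr ω.2) _).1 rfl
    ext ω t
    · have h := (hrc ω).pathIntegral_eq (h := fun k ↦ c * (orthogonalDirection k).1) .of_discrete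
        (fun r _ ↦ (abs_mul_orthogonalDirection_le c (directionOfSigns (S₁ r ω.1) (S₂ r ω.2))).1)
        t.coe_nonneg
      refine Eq.trans ?_ h.symm
      simp only [hU, hV]
      rw [← intervalIntegral.integral_add
        (h₁.intervalIntegrable _ ω.1 le_rfl t.coe_nonneg)
        (h₂.intervalIntegrable _ ω.2 le_rfl t.coe_nonneg)]
      refine intervalIntegral.integral_congr_uIoo fun r hr ↦ ?_
      rw [uIoo_of_le t.coe_nonneg] at hr
      rw [orthogonalDirection_fst, ← (hsigns ω r hr.1).1, ← (hsigns ω r hr.1).2]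
      ring
    · have h := (hrc ω).pathIntegral_eq (h := fun k ↦ c * (orthogonalDirection k).2) .of_discrete
        (fun r _ ↦ (abs_mul_orthogonalDirection_le c (directionOfSigns (S₁ r ω.1) (S₂ r ω.2))).2)
        t.coe_nonneg
      refine Eq.trans ?_ h.symm
      simp only [hU, hV]
      rw [← intervalIntegral.integral_sub
        (h₁.intervalIntegrable _ ω.1 le_rfl t.coe_nonneg)
        (h₂.intervalIntegrable _ ω.2 le_rfl t.coe_nonneg)]
      refine intervalIntegral.integral_congr_uIoo fun r hr ↦ ?_
      rw [uIoo_of_le t.coe_nonneg] at hr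
      rw [orthogonalDirection_snd, ← (hsigns ω r hr.1).1, ← (hsigns ω r hr.1).2]
      ring
  let G : (ℝ≥0 → ℝ) × (ℝ≥0 → ℝ) → ℝ≥0 → ℝ × ℝ := fun q t ↦ (q.1 t + q.2 t, q.1 t - q.2 t)
  have hG : Measurable G := by
    refine measurable_pi_lambda _ fun t ↦ ?_
    have a1 : Measurable fun q : (ℝ≥0 → ℝ) × (ℝ≥0 → ℝ) ↦ q.1 t :=
      (measurable_pi_apply t).comp measurable_fst
    have a2 : Measurable fun q : (ℝ≥0 → ℝ) × (ℝ≥0 → ℝ) ↦ q.2 t :=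
      (measurable_pi_apply t).comp measurable_snd
    exact (a1.add a2).prodMk (a1.sub a2)
  have hjoint : P'.map (fun ω ↦ ((fun t ↦ U t ω), (fun t ↦ V t ω))) =
      (P'.prod P').map (Prod.map (fun ω t ↦ U t ω) (fun ω t ↦ V t ω)) := by
    rw [(indepFun_iff_map_prod_eq_prod_map_map hUm.aemeasurable hVm.aemeasurable).1 hUV,
      Measure.map_prod_map _ _ hUm hVm]
  refine ⟨?_, ?_, ?_⟩
  · rw [e1]; exact (hΨ.comp hDm).aemeasurable
  · exact (hG.comp (hUm.prodMk hVm)).aemeasurable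
  · rw [e1, ← Measure.map_map hΨ hDm, hlaw, Measure.map_map hΨ hSm, ← e2]
    change (P'.prod P').map (G ∘ (Prod.map (fun ω t ↦ U t ω) (fun ω t ↦ V t ω))) =
      P'.map (G ∘ fun ω ↦ ((fun t ↦ U t ω), (fun t ↦ V t ω)))
    rw [← Measure.map_map hG (hUm.prodMap hVm), ← Measure.map_map hG (hUm.prodMk hVm), hjoint]

end

/-! ### Independence of the past signs and the future events -/

/-- Associativity of independence for three variables. -/
lemma indepFun_prodMk_left_of_indepFun {Ω α β γ : Type*} [MeasurableSpace Ω] [MeasurableSpace α]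
    [MeasurableSpace β] [MeasurableSpace γ] {P : Measure Ω} [IsFiniteMeasure P] {f : Ω → α}
    {g : Ω → β} {h : Ω → γ} (hf : Measurable f) (hg : Measurable g) (hh : Measurable h)
    (h1 : IndepFun f (fun ω ↦ (g ω, h ω)) P) (h2 : IndepFun g h P) :
    IndepFun (fun ω ↦ (f ω, g ω)) h P := by
  have h3 : IndepFun f g P := h1.comp measurable_id measurable_fst
  rw [indepFun_iff_map_prod_eq_prod_map_map hf.aemeasurable (by fun_prop)] at h1
  rw [indepFun_iff_map_prod_eq_prod_map_map (by fun_prop) (by fun_prop)] at h2 h3 ⊢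
  rw [h2] at h1
  rw [h3]
  have h4 := congrArg (Measure.map MeasurableEquiv.prodAssoc.symm) h1
  rw [← Measure.prodAssoc_prod, Measure.map_map (by fun_prop) (by fun_prop),
    Measure.map_map (by fun_prop) (by fun_prop)] at h4
  have h5 : (MeasurableEquiv.prodAssoc.symm : α × β × γ → (α × β) × γ) ∘
      (MeasurableEquiv.prodAssoc : (α × β) × γ → α × β × γ) = id := by
    ext x <;> rfl
  rw [h5, Measure.map_id] at h4
  exact h4

section

variable {Ω : Type*} [MeasurableSpace Ω] {P : Measure Ω} {rate : ℝ → ℝ} {T : Ω → Set ℝ}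
  {S : ℝ → Ω → ℝ}

/-- The sign at the first of finitely many times and the event counts up to the `p`-th time are
jointly independent of the later event counts. -/
lemma IsTelegraphSign.indepFun_counts [IsProbabilityMeasure P] (hS : IsTelegraphSign rate T S P)
    {t : ℕ → ℝ} (ht : Monotone t) (h0 : 0 < t 0) (p m : ℕ) :
    IndepFun
      (fun ω ↦ (S (t 0) ω, fun j : ℕ ↦ if j < p then eventCount T (t j) (t (j + 1)) ω else 0))
      (fun ω (j : ℕ) ↦ if p ≤ j ∧ j < m then eventCount T (t j) (t (j + 1)) ω else 0) P := by
  have hpos : ∀ i, 0 < t i := fun i ↦ h0.trans_le (ht (Nat.zero_le i))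
  have hN : ∀ j, Measurable fun ω ↦ eventCount T (t j) (t (j + 1)) ω := fun j ↦
    hS.events.measurable _ _ (hpos j)
  have hA : Measurable fun ω (j : ℕ) ↦ if j < p then eventCount T (t j) (t (j + 1)) ω else 0 :=
    measurable_pi_lambda _ fun j ↦ Measurable.ite (.const _) (hN j) measurable_const
  have hB : Measurable fun ω (j : ℕ) ↦
      if p ≤ j ∧ j < m then eventCount T (t j) (t (j + 1)) ω else 0 :=
    measurable_pi_lambda _ fun j ↦ Measurable.ite (.const _) (hN j) measurable_const
  have hev : ∀ u, Measurable fun ν : ℝ → ℕ ↦ ν u := fun u ↦ measurable_pi_apply u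
  refine indepFun_prodMk_left_of_indepFun (hS.measurable _ h0) hA hB ?_ ?_
  · let φ : (ℝ → ℕ) → (ℕ → ℕ) × (ℕ → ℕ) := fun ν ↦
      (fun j ↦ if j < p then ν (t (j + 1)) - ν (t j) else 0,
        fun j ↦ if p ≤ j ∧ j < m then ν (t (j + 1)) - ν (t j) else 0)
    have hφ : Measurable φ := by
      have hsub : ∀ j, Measurable fun ν : ℝ → ℕ ↦ ν (t (j + 1)) - ν (t j) := fun j ↦
        (hev _).sub (hev _)
      exact Measurable.prodMk
        (measurable_pi_lambda _ fun j ↦ Measurable.ite (.const _) (hsub j) measurable_const)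
        (measurable_pi_lambda _ fun j ↦ Measurable.ite (.const _) (hsub j) measurable_const)
    have h := (hS.indep _ h0).comp measurable_id hφ
    have hdiff : ∀ ω j, eventCount T (t j) (t (j + 1)) ω =
        eventCount T (t 0) (t (j + 1)) ω - eventCount T (t 0) (t j) ω := fun ω j ↦ by
      rw [eventCount_add (hS.events.finite ω) h0 (ht (Nat.zero_le j)) (ht (Nat.le_add_right j 1)),
        Nat.add_sub_cancel_left]
    simp only [hdiff]
    exact h
  · have h := (hS.events.indep t ht h0).indepFun_finset (Finset.range p) (Finset.Ico p m)
      (Finset.disjoint_left.2 fun i hi hi' ↦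
        absurd (Finset.mem_range.1 hi) (Finset.mem_Ico.1 hi').1.not_gt) hN
    have h' := h.comp
      (φ := fun (x : Finset.range p → ℕ) (j : ℕ) ↦
        if hj : j ∈ Finset.range p then x ⟨j, hj⟩ else 0)
      (ψ := fun (x : Finset.Ico p m → ℕ) (j : ℕ) ↦
        if hj : j ∈ Finset.Ico p m then x ⟨j, hj⟩ else 0)
      (measurable_pi_lambda _ fun j ↦ .of_discrete) (measurable_pi_lambda _ fun j ↦ .of_discrete)
    convert h' using 1
    · ext ω j
      simp
    · ext ω j
      simp

/-- The signs up to time `a` are independent of the events after time `a`. -/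
lemma IsTelegraphSign.indepFun_past_future [IsProbabilityMeasure P]
    (hS : IsTelegraphSign rate T S P) {a : ℝ} (ha : 0 < a) :
    IndepFun (fun ω (r : Ioi (0 : ℝ)) ↦ S (min r a) ω)
      (fun ω (r : Ioi (0 : ℝ)) ↦ eventCount T a r ω) P := by
  refine IndepFun.process_indepFun_process (fun r ↦ hS.measurable _ (lt_min r.2 ha))
    (fun r ↦ hS.events.measurable _ _ ha) fun I J ↦ ?_
  -- the times of both families, ordered, with `a` as the `p`-th of them
  obtain ⟨t, ht, h0, m, hK⟩ := exists_monotone_enumeration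
    (insert a (I.image (fun r : Ioi (0 : ℝ) ↦ min (r : ℝ) a) ∪
      J.image (fun r : Ioi (0 : ℝ) ↦ max (r : ℝ) a))) (by
      intro r hr
      simp only [Finset.mem_insert, Finset.mem_union, Finset.mem_image] at hr
      rcases hr with rfl | ⟨x, -, rfl⟩ | ⟨x, -, rfl⟩
      exacts [ha, lt_min x.2 ha, lt_max_of_lt_right ha])
  have hpos : ∀ i, 0 < t i := fun i ↦ h0.trans_le (ht (Nat.zero_le i))
  obtain ⟨p, -, hp⟩ := hK a (Finset.mem_insert_self _ _)
  have hI : ∀ r : I, ∃ i ≤ p, t i = min (r : ℝ) a := by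
    intro r
    obtain ⟨i, -, hi⟩ := hK (min (r : ℝ) a) (Finset.mem_insert_of_mem (Finset.mem_union_left _
      (Finset.mem_image.2 ⟨r, r.2, rfl⟩)))
    rcases le_total i p with h | h
    · exact ⟨i, h, hi⟩
    · exact ⟨p, le_rfl, le_antisymm (hi ▸ ht h) (hp ▸ min_le_right _ _)⟩
  have hJ : ∀ r : J, ∃ i, p ≤ i ∧ i ≤ max m p ∧ t i = max (r : ℝ) a := by
    intro r
    obtain ⟨i, him, hi⟩ := hK (max (r : ℝ) a) (Finset.mem_insert_of_mem (Finset.mem_union_right _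
      (Finset.mem_image.2 ⟨r, r.2, rfl⟩)))
    rcases le_total p i with h | h
    · exact ⟨i, h, him.trans (le_max_left _ _), hi⟩
    · exact ⟨p, le_rfl, le_max_right _ _, le_antisymm (hp ▸ le_max_right _ _) (hi ▸ ht h)⟩
  choose i hip hi using hI
  choose k hpk hkm hk using hJ
  have h := (hS.indepFun_counts ht h0 p (max m p)).comp
    (φ := fun (q : ℝ × (ℕ → ℕ)) (r : I) ↦ q.1 * ∏ j ∈ Finset.range (i r), (-1 : ℝ) ^ q.2 j)
    (ψ := fun (x : ℕ → ℕ) (r : J) ↦ ∑ j ∈ Finset.Ico p (k r), x j)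
    (by
      have hev : ∀ j, Measurable fun q : ℝ × (ℕ → ℕ) ↦ (-1 : ℝ) ^ q.2 j := fun j ↦
        (Measurable.of_discrete (f := fun n : ℕ ↦ (-1 : ℝ) ^ n)).comp
          ((measurable_pi_apply j).comp measurable_snd)
      exact measurable_pi_lambda _ fun r ↦
        measurable_fst.mul (Finset.measurable_prod _ fun j _ ↦ hev j))
    (measurable_pi_lambda _ fun r ↦ Finset.measurable_sum _ fun j _ ↦ measurable_pi_apply j)
  convert h using 1
  · ext ω r
    simp only [Function.comp_apply]
    rw [← hi r, hS.switch (t 0) (t (i r)) h0 (ht (Nat.zero_le _)),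
      eventCount_eq_sum (hS.events.finite ω) ht h0 (Nat.zero_le _), ← Finset.range_eq_Ico,
      ← Finset.prod_pow_eq_pow_sum]
    congr 1
    refine Finset.prod_congr rfl fun j hj ↦ ?_
    rw [if_pos ((Finset.mem_range.1 hj).trans_le (hip r))]
  · ext ω r
    simp only [Function.comp_apply]
    have e1 : eventCount T a r ω = eventCount T (t p) (t (k r)) ω := by
      rw [hk, hp]
      rcases le_total (r : ℝ) a with h | h
      · rw [max_eq_right h, eventCount_of_le h, eventCount_of_le le_rfl]
      · rw [max_eq_left h]
    rw [e1, eventCount_eq_sum (hS.events.finite ω) ht h0 (hpk r)]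
    refine Finset.sum_congr rfl fun j hj ↦ ?_
    rw [if_pos ⟨(Finset.mem_Ico.1 hj).1, (Finset.mem_Ico.1 hj).2.trans_le (hkm r)⟩]

end

/-! ### Absolute continuity inside the range of the telegraph process -/

section

variable {Ω : Type*} {T : Ω → Set ℝ}

/-- The functional of the event counts after time `a` that equals `2 σ - t` when `σ` is the only
event in `(a, t]`. -/
noncomputable def parityIntegral (t : ℝ) (ν : Ioi (0 : ℝ) → ℕ) : ℝ :=
  pathIntegral (fun n : ℕ ↦ (-1 : ℝ) ^ n) ν t

lemma measurable_parityIntegral (t : ℝ) : Measurable (parityIntegral t) :=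
  measurable_pathIntegral .of_discrete t

lemma rightConstant_eventCount {ω : Ω} (hT : ∀ s t, 0 < s → (T ω ∩ Ioc s t).Finite) {a : ℝ}
    (ha : 0 < a) : RightConstant fun r ↦ eventCount T a r ω := by
  intro r hr
  rcases lt_or_ge r a with h | h
  · filter_upwards [nhdsWithin_le_nhds (eventually_lt_nhds h)] with s hs
    rw [eventCount_of_le hs.le, eventCount_of_le h.le]
  · filter_upwards [eventually_eventCount_eq_zero hT hr, self_mem_nhdsWithin] with s hs hrs
    rw [eventCount_add hT ha h (le_of_lt hrs), hs, add_zero]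

lemma parityIntegral_eq {ω : Ω} (hT : ∀ s t, 0 < s → (T ω ∩ Ioc s t).Finite) {a t : ℝ}
    (ha : 0 < a) (ht : 0 ≤ t) :
    parityIntegral t (fun r ↦ eventCount T a r ω) =
      ∫ r in (0 : ℝ)..t, (-1 : ℝ) ^ eventCount T a r ω :=
  (rightConstant_eventCount hT ha).pathIntegral_eq (h := fun n : ℕ ↦ (-1 : ℝ) ^ n) (C := 1)
    .of_discrete (fun r _ ↦ by simp) ht

lemma intervalIntegrable_neg_one_pow_eventCount {ω : Ω}
    (hT : ∀ s t, 0 < s → (T ω ∩ Ioc s t).Finite) {a s t : ℝ} (ha : 0 < a) (hs : 0 ≤ s)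
    (ht : 0 ≤ t) :
    IntervalIntegrable (fun r ↦ (-1 : ℝ) ^ eventCount T a r ω) volume s t :=
  (rightConstant_eventCount hT ha).intervalIntegrable (h := fun n : ℕ ↦ (-1 : ℝ) ^ n) (C := 1)
    .of_discrete (fun r _ ↦ by simp) hs ht

/-- With exactly one event in `(a, t]`, the parity integral locates it. -/
lemma exists_single_event {ω : Ω} (hT : ∀ s t, 0 < s → (T ω ∩ Ioc s t).Finite) {a t : ℝ}
    (ha : 0 < a) (h1 : eventCount T a t ω = 1) :
    ∃ σ ∈ Ioc a t, T ω ∩ Ioc a t = {σ} ∧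
      parityIntegral t (fun r ↦ eventCount T a r ω) = 2 * σ - t := by
  obtain ⟨σ, hσ⟩ := ncard_eq_one.1 h1
  have hmem : σ ∈ T ω ∩ Ioc a t := hσ ▸ mem_singleton σ
  have hσ0 : 0 < σ := ha.trans hmem.2.1
  have ht0 : 0 < t := hσ0.trans_le hmem.2.2
  refine ⟨σ, hmem.2, hσ, ?_⟩
  have hzero : ∀ r < σ, eventCount T a r ω = 0 := by
    intro r hr
    rw [eventCount_eq_zero_iff hT ha]
    refine eq_empty_of_forall_notMem fun x hx ↦ ?_
    have : x ∈ T ω ∩ Ioc a t := ⟨hx.1, hx.2.1, (hx.2.2.trans hr.le).trans hmem.2.2⟩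
    rw [hσ, mem_singleton_iff] at this
    exact (this ▸ hx.2.2).not_gt hr
  have hone : ∀ r, σ ≤ r → r ≤ t → eventCount T a r ω = 1 := by
    intro r hr hrt
    rw [eventCount, ncard_eq_one]
    refine ⟨σ, Subset.antisymm ?_ ?_⟩
    · rw [← hσ]
      exact inter_subset_inter_right _ (Ioc_subset_Ioc_right hrt)
    · exact singleton_subset_iff.2 ⟨hmem.1, hmem.2.1, hr⟩
  rw [parityIntegral_eq hT ha ht0.le, ← intervalIntegral.integral_add_adjacent_intervals
    (intervalIntegrable_neg_one_pow_eventCount hT ha le_rfl hσ0.le)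
    (intervalIntegrable_neg_one_pow_eventCount hT ha hσ0.le ht0.le)]
  have e1 : ∫ r in (0 : ℝ)..σ, (-1 : ℝ) ^ eventCount T a r ω = ∫ _ in (0 : ℝ)..σ, (1 : ℝ) := by
    refine intervalIntegral.integral_congr_uIoo fun r hr ↦ ?_
    rw [uIoo_of_le hσ0.le] at hr
    simp [hzero r hr.2]
  have e2 : ∫ r in σ..t, (-1 : ℝ) ^ eventCount T a r ω = ∫ _ in σ..t, (-1 : ℝ) := by
    refine intervalIntegral.integral_congr_uIoo fun r hr ↦ ?_
    rw [uIoo_of_le hmem.2.2] at hr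
    simp [hone r hr.1.le hr.2.le]
  rw [e1, e2]
  simp
  ring

end

section

variable {Ω : Type*} [MeasurableSpace Ω] {P : Measure Ω} {rate : ℝ → ℝ} {T : Ω → Set ℝ}
  {S : ℝ → Ω → ℝ}

lemma IsPoissonEvents.measure_eventCount_eq_zero (hT : IsPoissonEvents rate T P)
    (hn : ∀ t, 0 < t → 0 ≤ rate t) {s t : ℝ} (hs : 0 < s) (hst : s ≤ t) :
    P {ω | eventCount T s t ω = 0} = ENNReal.ofReal (Real.exp (-∫ r in s..t, rate r)) := by
  have h0 : 0 ≤ ∫ r in s..t, rate r :=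
    intervalIntegral.integral_nonneg hst fun r hr ↦ hn r (hs.trans_le hr.1)
  have h := hT.measure_eventCount hs hst {0}
  rw [poissonMeasure_singleton, Real.coe_toNNReal _ h0] at h
  simpa using h

/-- The probability that there is exactly one event in `(a, t]` and that it falls into `(x, y]`. -/
lemma IsPoissonEvents.measure_single_event (hT : IsPoissonEvents rate T P)
    (hi : ∀ s t, 0 < s → 0 < t → IntervalIntegrable rate volume s t)
    (hn : ∀ t, 0 < t → 0 ≤ rate t) {a x y t : ℝ} (ha : 0 < a) (hax : a ≤ x) (hxy : x ≤ y)
    (hyt : y ≤ t) :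
    P {ω | eventCount T a x ω = 0 ∧ eventCount T x y ω = 1 ∧ eventCount T y t ω = 0} =
      ENNReal.ofReal (Real.exp (-∫ r in a..t, rate r) * ∫ r in x..y, rate r) := by
  have hx := ha.trans_le hax
  have hy := hx.trans_le hxy
  have ht := hy.trans_le hyt
  let τ : ℕ → ℝ := fun n ↦ match n with
    | 0 => a
    | 1 => x
    | 2 => y
    | _ => t
  have hτ : Monotone τ := monotone_nat_of_le_succ fun n ↦ match n with
    | 0 => hax
    | 1 => hxy
    | 2 => hyt
    | _ + 3 => le_rfl
  have h := (hT.indep τ hτ ha).measure_inter_preimage_eq_mul (Finset.range 3)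
    (sets := fun n ↦ if n = 1 then {1} else {0}) fun _ _ ↦ .of_discrete
  have hset : {ω | eventCount T a x ω = 0 ∧ eventCount T x y ω = 1 ∧ eventCount T y t ω = 0} =
      ⋂ i ∈ Finset.range 3, (fun ω ↦ eventCount T (τ i) (τ (i + 1)) ω) ⁻¹'
        (if i = 1 then {1} else {0}) := by
    ext ω
    simp only [Finset.range_add_one, mem_ofPred_eq, mem_iInter]
    simp [τ]
    tauto
  have h0 : ∀ {s u : ℝ}, 0 < s → s ≤ u → 0 ≤ ∫ r in s..u, rate r := fun hs hsu ↦
    intervalIntegral.integral_nonneg hsu fun r hr ↦ hn r (hs.trans_le hr.1)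
  have e1 : P ((fun ω ↦ eventCount T a x ω) ⁻¹' {0}) =
      ENNReal.ofReal (Real.exp (-∫ r in a..x, rate r)) :=
    hT.measure_eventCount_eq_zero hn ha hax
  have e2 : P ((fun ω ↦ eventCount T y t ω) ⁻¹' {0}) =
      ENNReal.ofReal (Real.exp (-∫ r in y..t, rate r)) :=
    hT.measure_eventCount_eq_zero hn hy hyt
  have e3 : P ((fun ω ↦ eventCount T x y ω) ⁻¹' {1}) =
      ENNReal.ofReal (Real.exp (-∫ r in x..y, rate r) * ∫ r in x..y, rate r) := by
    have h := hT.measure_eventCount hx hxy {1}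
    rw [poissonMeasure_singleton, Real.coe_toNNReal _ (h0 hx hxy)] at h
    refine Eq.trans (b := P {ω | eventCount T x y ω = 1}) rfl ?_
    simpa using h
  rw [hset, h, Finset.prod_range_succ, Finset.prod_range_succ, Finset.prod_range_one]
  change P ((fun ω ↦ eventCount T a x ω) ⁻¹' {0}) * P ((fun ω ↦ eventCount T x y ω) ⁻¹' {1}) *
    P ((fun ω ↦ eventCount T y t ω) ⁻¹' {0}) = _
  rw [e1, e2, e3, ← ENNReal.ofReal_mul (by positivity),
    ← ENNReal.ofReal_mul (by have := h0 hx hxy; positivity)]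
  congr 1
  rw [← intervalIntegral.integral_add_adjacent_intervals (hi a x ha hx) (hi x t hx ht),
    ← intervalIntegral.integral_add_adjacent_intervals (hi x y hx hy) (hi y t hy ht),
    neg_add, neg_add, Real.exp_add, Real.exp_add]
  ring

/-- On the event of exactly one jump in `(a, t]`, the time of the jump has an absolutely
continuous law. -/
lemma IsPoissonEvents.map_single_event_absolutelyContinuous [IsFiniteMeasure P]
    (hT : IsPoissonEvents rate T P)
    (hi : ∀ s t, 0 < s → 0 < t → IntervalIntegrable rate volume s t)
    (hn : ∀ t, 0 < t → 0 ≤ rate t) {a t : ℝ} (ha : 0 < a) :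
    (P.restrict {ω | eventCount T a t ω = 1}).map
      (fun ω ↦ (parityIntegral t (fun r ↦ eventCount T a r ω) + t) / 2) ≪ volume := by
  have hm : Measurable fun ω ↦ (parityIntegral t (fun r ↦ eventCount T a r ω) + t) / 2 :=
    (((measurable_parityIntegral t).comp (measurable_pi_lambda _ fun r ↦
      hT.measurable a r ha)).add_const t).div_const 2
  have hac : (ENNReal.ofReal (Real.exp (-∫ r in a..t, rate r)) •
      (volume.restrict (Ioc a t)).withDensity fun r ↦ ENNReal.ofReal (rate r)) ≪ volume :=
    ((withDensity_absolutelyContinuous _ _).trans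
      Measure.restrict_le_self.absolutelyContinuous).smul_left _
  suffices heq : (P.restrict {ω | eventCount T a t ω = 1}).map
      (fun ω ↦ (parityIntegral t (fun r ↦ eventCount T a r ω) + t) / 2) =
      ENNReal.ofReal (Real.exp (-∫ r in a..t, rate r)) •
        (volume.restrict (Ioc a t)).withDensity fun r ↦ ENNReal.ofReal (rate r) from heq ▸ hac
  -- the event falls into `(x, y]` iff the counts are `0`, `1`, `0` before, in and after it
  refine Measure.ext_of_Ioc _ _ fun x y hxy ↦ ?_
  rw [Measure.map_apply hm measurableSet_Ioc, Measure.restrict_apply (hm measurableSet_Ioc),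
    Measure.smul_apply, withDensity_apply _ measurableSet_Ioc,
    Measure.restrict_restrict measurableSet_Ioc, Ioc_inter_Ioc, smul_eq_mul]
  have hval : ∀ ω, eventCount T a t ω = 1 → ∃ σ ∈ Ioc a t, T ω ∩ Ioc a t = {σ} ∧
      (parityIntegral t (fun r ↦ eventCount T a r ω) + t) / 2 = σ := by
    intro ω h
    obtain ⟨σ, h1, h2, h3⟩ := exists_single_event (hT.finite ω) ha h
    exact ⟨σ, h1, h2, by rw [h3]; ring⟩
  rcases lt_or_ge (min y t) (max x a) with hlt | hle
  · rw [Ioc_eq_empty_of_le hlt.le, Measure.restrict_empty, lintegral_zero_measure, mul_zero]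
    have : (fun ω ↦ (parityIntegral t (fun r ↦ eventCount T a r ω) + t) / 2) ⁻¹' Ioc x y ∩
        {ω | eventCount T a t ω = 1} = ∅ := by
      refine eq_empty_of_forall_notMem fun ω hω ↦ ?_
      obtain ⟨σ, h1, -, h3⟩ := hval ω hω.2
      have h4 := hω.1
      rw [mem_preimage, h3] at h4
      exact absurd (max_lt h4.1 h1.1) (not_lt.2 ((le_min h4.2 h1.2).trans hlt.le))
    rw [this, measure_empty]
  · have hax : a ≤ max x a := le_max_right _ _
    have hyt : min y t ≤ t := min_le_right _ _
    have hx0 : 0 < max x a := ha.trans_le hax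
    have hy0 : 0 < min y t := hx0.trans_le hle
    have hset : (fun ω ↦ (parityIntegral t (fun r ↦ eventCount T a r ω) + t) / 2) ⁻¹' Ioc x y ∩
        {ω | eventCount T a t ω = 1} = {ω | eventCount T a (max x a) ω = 0 ∧
          eventCount T (max x a) (min y t) ω = 1 ∧ eventCount T (min y t) t ω = 0} := by
      ext ω
      have hadd : eventCount T a t ω = eventCount T a (max x a) ω +
          eventCount T (max x a) (min y t) ω + eventCount T (min y t) t ω := by
        rw [eventCount_add (hT.finite ω) ha hax (hle.trans hyt),
          eventCount_add (hT.finite ω) hx0 hle hyt, add_assoc]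
      constructor
      · rintro ⟨h1, h2⟩
        obtain ⟨σ, h3, h4, h5⟩ := hval ω h2
        rw [mem_preimage, h5] at h1
        have hσ : T ω ∩ Ioc a t = {σ} := h4
        have hne : eventCount T (max x a) (min y t) ω ≠ 0 := by
          rw [Ne, eventCount_eq_zero_iff (hT.finite ω) hx0]
          refine Nonempty.ne_empty ⟨σ, ?_, max_lt h1.1 h3.1, le_min h1.2 h3.2⟩
          exact (hσ ▸ mem_singleton σ : σ ∈ T ω ∩ Ioc a t).1
        have h2' : eventCount T a t ω = 1 := h2
        change _ ∧ _ ∧ _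
        lia
      · rintro ⟨h1, h2, h3⟩
        have h4 : eventCount T a t ω = 1 := by lia
        refine ⟨?_, h4⟩
        obtain ⟨σ, -, h6, h7⟩ := hval ω h4
        rw [mem_preimage, h7]
        obtain ⟨σ', hσ'⟩ := ncard_eq_one.1 h2
        have hmem : σ' ∈ T ω ∩ Ioc (max x a) (min y t) := hσ' ▸ mem_singleton σ'
        have hmem' : σ' ∈ T ω ∩ Ioc a t :=
          ⟨hmem.1, hax.trans_lt hmem.2.1, hmem.2.2.trans hyt⟩
        rw [h6, mem_singleton_iff] at hmem'
        rw [← hmem']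
        exact ⟨(le_max_left _ _).trans_lt hmem.2.1, hmem.2.2.trans (min_le_left _ _)⟩
    rw [hset, hT.measure_single_event hi hn ha hax hle hyt, ENNReal.ofReal_mul (by positivity),
      intervalIntegral.integral_of_le hle, ofReal_integral_eq_lintegral_ofReal]
    · exact (intervalIntegrable_iff_integrableOn_Ioc_of_le hle).1 (hi _ _ hx0 hy0)
    · filter_upwards [ae_restrict_mem measurableSet_Ioc] with r hr
      exact hn r (hx0.trans hr.1)

end

lemma integral_eq_of_forall_eq {Ω : Type*} {S : ℝ → Ω → ℝ} (v : ℝ) (ω : Ω) {t s : ℝ} (ht : 0 ≤ t)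
    (h : ∀ r : ℝ, 0 < r → r < t → S r ω = s) :
    ∫ r in (0 : ℝ)..t, v * S r ω = v * t * s := by
  have : ∫ r in (0 : ℝ)..t, v * S r ω = ∫ _ in (0 : ℝ)..t, v * s := by
    refine intervalIntegral.integral_congr_uIoo fun r hr ↦ ?_
    rw [uIoo_of_le ht] at hr
    simp only [h r hr.1 hr.2]
  rw [this]
  simp
  ring

/-- A finite set has a gap to the left of each of its points. -/
lemma exists_inter_Ioc_eq_singleton {A : Set ℝ} {c x : ℝ} (hA : (A ∩ Ioc c x).Finite) (hx : x ∈ A)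
    (hcx : c < x) : ∃ b, c ≤ b ∧ b < x ∧ A ∩ Ioc b x = {x} := by
  obtain ⟨b, hb, hbmax⟩ := exists_max_image _ id
    ((hA.subset (sdiff_subset (t := {x}))).insert c) ⟨_, mem_insert _ _⟩
  have hcb : c ≤ b := hbmax _ (mem_insert _ _)
  have hbx : b < x := by
    rcases hb with rfl | hb
    · exact hcx
    · exact lt_of_le_of_ne hb.1.2.2 hb.2
  refine ⟨b, hcb, hbx, Subset.antisymm (fun y hy ↦ ?_) (singleton_subset_iff.2 ⟨hx, hbx, le_rfl⟩)⟩
  by_contra hyx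
  exact (hbmax y (mem_insert_of_mem _ ⟨⟨hy.1, hcb.trans_lt hy.2.1, hy.2.2⟩, hyx⟩)).not_gt hy.2.1

section

variable {Ω : Type*} [MeasurableSpace Ω] {P : Measure Ω} {rate : ℝ → ℝ} {T : Ω → Set ℝ}
  {S : ℝ → Ω → ℝ}

/-- The position at time `t` as a function of the signs up to time `a` and of the event counts
after time `a`. -/
lemma IsTelegraphSign.integral_eq_add (hS : IsTelegraphSign rate T S P) (v : ℝ) (ω : Ω) {a t : ℝ}
    (ha : 0 < a) (hat : a ≤ t) :
    ∫ r in (0 : ℝ)..t, v * S r ω = (∫ r in (0 : ℝ)..a, v * S r ω) +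
      v * S a ω * (parityIntegral t (fun r ↦ eventCount T a r ω) - a) := by
  have ht := ha.le.trans hat
  rw [← intervalIntegral.integral_add_adjacent_intervals
    (hS.intervalIntegrable v ω le_rfl ha.le) (hS.intervalIntegrable v ω ha.le ht),
    parityIntegral_eq (hS.events.finite ω) ha ht,
    ← intervalIntegral.integral_add_adjacent_intervals
    (intervalIntegrable_neg_one_pow_eventCount (hS.events.finite ω) ha le_rfl ha.le)
    (intervalIntegrable_neg_one_pow_eventCount (hS.events.finite ω) ha ha.le ht)]
  have e1 : ∫ r in (0 : ℝ)..a, (-1 : ℝ) ^ eventCount T a r ω = a := by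
    have : ∫ r in (0 : ℝ)..a, (-1 : ℝ) ^ eventCount T a r ω = ∫ _ in (0 : ℝ)..a, (1 : ℝ) := by
      refine intervalIntegral.integral_congr fun r hr ↦ ?_
      rw [uIcc_of_le ha.le] at hr
      simp [eventCount_of_le hr.2]
    rw [this]
    simp
  rw [e1, add_sub_cancel_left, ← intervalIntegral.integral_const_mul]
  congr 1
  refine intervalIntegral.integral_congr fun r hr ↦ ?_
  rw [uIcc_of_le hat] at hr
  rw [hS.switch a r ha hr.1, mul_assoc]

/-- The event of exactly one jump in `(a, t]` does not charge null sets of positions at time `t`: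
the position depends affinely on the time of the jump, which is independent of the past. -/
lemma IsTelegraphSign.measure_single_event_null [IsProbabilityMeasure P]
    (hS : IsTelegraphSign rate T S P)
    (hi : ∀ s t, 0 < s → 0 < t → IntervalIntegrable rate volume s t)
    (hn : ∀ t, 0 < t → 0 ≤ rate t) {v a t : ℝ} (hv : v ≠ 0) (ha : 0 < a) (hat : a ≤ t)
    {B : Set ℝ} (hB : MeasurableSet B) (hB0 : volume B = 0) :
    P {ω | eventCount T a t ω = 1 ∧ ∫ r in (0 : ℝ)..t, v * S r ω ∈ B} = 0 := by
  let t' : Ioi (0 : ℝ) := ⟨t, ha.trans_le hat⟩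
  let F : Ω → Ioi (0 : ℝ) → ℕ := fun ω r ↦ eventCount T a r ω
  let W : (Ioi (0 : ℝ) → ℝ) → ℝ × ℝ := fun d ↦ (pathIntegral (fun x ↦ v * x) d a, d ⟨a, ha⟩)
  let Pst : Ω → Ioi (0 : ℝ) → ℝ := fun ω r ↦ S (min r a) ω
  have hW : Measurable W :=
    (measurable_pathIntegral (measurable_id.const_mul v) a).prodMk (measurable_pi_apply _)
  have hF : Measurable F := measurable_pi_lambda _ fun r ↦ hS.events.measurable a r ha
  have hPst : Measurable Pst := measurable_pi_lambda _ fun r ↦ hS.measurable _ (lt_min r.2 ha)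
  have hind : IndepFun F (W ∘ Pst) P := (hS.indepFun_past_future ha).symm.comp measurable_id hW
  have hWval : ∀ ω, W (Pst ω) = (∫ r in (0 : ℝ)..a, v * S r ω, S a ω) := by
    intro ω
    have hrc : RightConstant fun r ↦ S (min r a) ω := by
      intro r hr
      rcases lt_or_ge r a with h | h
      · filter_upwards [hS.rightConstant ω r hr, nhdsWithin_le_nhds (eventually_lt_nhds h)]
          with s hs hsa
        rw [min_eq_left hsa.le, min_eq_left h.le, hs]
      · filter_upwards [self_mem_nhdsWithin] with s hs
        rw [min_eq_right h, min_eq_right (h.trans (le_of_lt hs))]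
    refine Prod.ext ?_ (by simp [W, Pst])
    have h := hrc.pathIntegral_eq (h := fun x ↦ v * x) (measurable_id.const_mul v)
      (fun r hr ↦ hS.abs_le v ω (min r a) (lt_min hr ha)) ha.le
    refine h.trans (intervalIntegral.integral_congr fun r hr ↦ ?_)
    rw [uIcc_of_le ha.le] at hr
    simp only [min_eq_left hr.2]
  let E : Set ((Ioi (0 : ℝ) → ℕ) × (ℝ × ℝ)) :=
    {q | q.1 t' = 1 ∧ q.2.1 + v * q.2.2 * (parityIntegral t q.1 - a) ∈ B}
  have hE : MeasurableSet E := by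
    have h1 : Measurable fun q : (Ioi (0 : ℝ) → ℕ) × (ℝ × ℝ) ↦ q.1 t' :=
      (measurable_pi_apply t').comp measurable_fst
    have h2 : Measurable fun q : (Ioi (0 : ℝ) → ℕ) × (ℝ × ℝ) ↦
        q.2.1 + v * q.2.2 * (parityIntegral t q.1 - a) :=
      measurable_snd.fst.add ((measurable_snd.snd.const_mul v).mul
        (((measurable_parityIntegral t).comp measurable_fst).sub_const a))
    exact (h1 (measurableSet_singleton 1)).inter (h2 hB)
  have hset : {ω | eventCount T a t ω = 1 ∧ ∫ r in (0 : ℝ)..t, v * S r ω ∈ B} =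
      {ω | (F ω, (W ∘ Pst) ω) ∈ E} := by
    ext ω
    simp only [mem_ofPred_eq, E, Function.comp_apply, hWval, hS.integral_eq_add v ω ha hat]
    rfl
  rw [hset, measure_prodMk_mem_of_indepFun hind hF (hW.comp hPst) hE, lintegral_eq_zero_iff'
    (by
      refine Measurable.aemeasurable ?_
      have h := (measurable_measure_prodMk_right (μ := P.map F) hE).comp (hW.comp hPst)
      convert h using 2 with ω
      exact (Measure.map_apply hF (measurable_prodMk_right hE)).symm)]
  refine Eventually.of_forall fun ω ↦ ?_
  simp only [Function.comp_apply, hWval, Pi.zero_apply]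
  set u := ∫ r in (0 : ℝ)..a, v * S r ω
  set α := v * S a ω
  have hα : α ≠ 0 := by
    rcases hS.sign a ha ω with h | h <;> simp [α, h, hv]
  have hac := hS.events.map_single_event_absolutelyContinuous hi hn (t := t) ha
  have hm : Measurable fun ω ↦ (parityIntegral t (fun r ↦ eventCount T a r ω) + t) / 2 :=
    (((measurable_parityIntegral t).comp hF).add_const t).div_const 2
  -- the position as an affine function of the time of the event
  have hnull : volume ((fun x ↦ u + α * (2 * x - t - a)) ⁻¹' B) = 0 := by
    have : (fun x ↦ u + α * (2 * x - t - a)) ⁻¹' B =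
        (fun x ↦ (2 * α) * x) ⁻¹' ((fun x ↦ (u - α * (t + a)) + x) ⁻¹' B) := by
      ext x
      simp only [mem_preimage]
      ring_nf
    rw [this, Real.volume_preimage_mul_left (by simpa using hα), measure_preimage_add, hB0,
      mul_zero]
  have h := hac hnull
  have haff : Measurable fun x : ℝ ↦ u + α * (2 * x - t - a) := by fun_prop
  rw [Measure.map_apply hm (haff hB), Measure.restrict_apply (hm (haff hB))] at h
  convert h using 2
  ext ω'
  simp only [E, mem_ofPred_eq, mem_inter_iff, mem_preimage, F, t']
  have e : u + α * (2 * (((parityIntegral t fun r ↦ eventCount T a r ω') + t) / 2) - t - a) =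
      u + v * S a ω * ((parityIntegral t fun r ↦ eventCount T a r ω') - a) := by
    simp only [α]
    ring
  rw [and_comm, e]

/-- Inside the range, the law of the telegraph process is absolutely continuous: at least one
event has occurred, and a rational time separates the last event from the earlier ones. -/
lemma IsTelegraphProcess.restrict_absolutelyContinuous [IsProbabilityMeasure P] {v : ℝ}
    {U : ℝ≥0 → Ω → ℝ} (hU : IsTelegraphProcess v rate U P)
    (hi : ∀ s t, 0 < s → 0 < t → IntervalIntegrable rate volume s t)
    (hn : ∀ t, 0 < t → 0 ≤ rate t) (hv : 0 < v) {t : ℝ≥0} (ht : 0 < t) :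
    (P.map (U t)).restrict (Ioo (-(v * t)) (v * t)) ≪ volume := by
  have hUm := hU.measurable t
  have ht' : (0 : ℝ) < t := ht
  obtain ⟨T, S, hS, hUS⟩ := hU
  refine Measure.AbsolutelyContinuous.mk fun B hB hB0 ↦ ?_
  rw [Measure.restrict_apply hB, Measure.map_apply hUm (hB.inter measurableSet_Ioo)]
  have hsub : U t ⁻¹' (B ∩ Ioo (-(v * t)) (v * t)) ⊆ ⋃ q : ℚ, ⋃ (_ : (0 : ℝ) < q ∧ (q : ℝ) ≤ t),
      {ω | eventCount T q t ω = 1 ∧ ∫ r in (0 : ℝ)..t, v * S r ω ∈ B} := by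
    rintro ω ⟨hωB, hω⟩
    rw [hUS] at hωB hω
    -- without events the position would be an end of the range
    have hne : (T ω ∩ Ioc 0 (t : ℝ)).Nonempty := by
      by_contra hempty
      rw [not_nonempty_iff_eq_empty] at hempty
      have hconst : ∀ r : ℝ, 0 < r → r < t → S r ω = S t ω := by
        intro r hr hrt
        have h0 : eventCount T r t ω = 0 := by
          rw [eventCount_eq_zero_iff (hS.events.finite ω) hr]
          exact subset_empty_iff.1
            ((inter_subset_inter_right _ (Ioc_subset_Ioc_left hr.le)).trans hempty.subset)
        rw [hS.switch r t hr hrt.le, h0, pow_zero, mul_one]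
      rw [integral_eq_of_forall_eq v ω t.coe_nonneg hconst] at hω
      rcases hS.sign t ht' ω with h | h <;> rw [h] at hω <;> simp at hω
    obtain ⟨e, heT, he0, het⟩ := hne
    have hfin := hS.events.finite ω (e / 2) t (by linarith)
    obtain ⟨σ, hσ, hσmax⟩ := exists_max_image _ id hfin ⟨e, heT, by linarith, het⟩
    have hσmax : ∀ y ∈ T ω ∩ Ioc (e / 2) (t : ℝ), y ≤ σ := hσmax
    obtain ⟨b, heb, hbσ, hb⟩ := exists_inter_Ioc_eq_singleton
      (hS.events.finite ω (e / 2) σ (by linarith)) hσ.1 hσ.2.1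
    obtain ⟨q, hbq, hqσ⟩ := exists_rat_btwn hbσ
    simp only [mem_iUnion]
    refine ⟨q, ⟨by linarith, hqσ.le.trans hσ.2.2⟩, ?_, hωB⟩
    rw [eventCount, ncard_eq_one]
    refine ⟨σ, Subset.antisymm (fun x hx ↦ ?_) (singleton_subset_iff.2 ⟨hσ.1, hqσ, hσ.2.2⟩)⟩
    rw [← hb]
    exact ⟨hx.1, hbq.trans hx.2.1,
      hσmax x ⟨hx.1, heb.trans_lt (hbq.trans hx.2.1), hx.2.2⟩⟩
  refine measure_mono_null hsub (measure_iUnion_null fun q ↦ measure_iUnion_null fun hq ↦ ?_)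
  exact hS.measure_single_event_null hi hn hv.ne' hq.1 hq.2 hB hB0

/-! ### The boundary atom of the telegraph process -/

/-- The right end of the range is reached when the sign is `1` at small times and no event occurs.
Since the sign is described at positive times only, the probability is computed as a limit: from
above through the events before time `t`, from below through the events after small times. -/
lemma IsTelegraphProcess.measure_eq_mul [IsProbabilityMeasure P] {v : ℝ}
    {U : ℝ≥0 → Ω → ℝ} (hU : IsTelegraphProcess v rate U P)
    (hn : ∀ t, 0 < t → 0 ≤ rate t) (hv : 0 < v) {t : ℝ≥0} (ht : 0 < t)
    (hint : IntervalIntegrable rate volume 0 t) :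
    P {ω | U t ω = v * t} = ENNReal.ofReal (1 / 2 * Real.exp (-∫ r in (0 : ℝ)..t, rate r)) := by
  have hUm := hU.measurable t
  have ht' : (0 : ℝ) < t := ht
  obtain ⟨T, S, hS, hUS⟩ := hU
  have hprob : ∀ s u, 0 < s → s ≤ u → P {ω | S s ω = 1 ∧ eventCount T s u ω = 0} =
      ENNReal.ofReal (1 / 2 * Real.exp (-∫ r in s..u, rate r)) := by
    intro s u hs hsu
    have h := (hS.indep s hs).measure_inter_preimage_eq_mul {1} {ν | ν u = 0}
      (measurableSet_singleton _) ((measurable_pi_apply u) (measurableSet_singleton 0))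
    have h1 : P (S s ⁻¹' {1}) = 1 / 2 := (hS.uniform s hs).1
    have h2 : P ((fun ω (t : ℝ) ↦ eventCount T s t ω) ⁻¹' {ν | ν u = 0}) =
        ENNReal.ofReal (Real.exp (-∫ r in s..u, rate r)) :=
      hS.events.measure_eventCount_eq_zero hn hs hsu
    rw [h1, h2] at h
    refine Eq.trans h ?_
    rw [ENNReal.ofReal_mul (by norm_num)]
    congr 1
    rw [ENNReal.ofReal_div_of_pos two_pos]
    simp
  -- `n + 3` instead of `n + 1` ensures `s n ≤ t - s n`
  let s : ℕ → ℝ := fun n ↦ t / (n + 3)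
  have hs0 : ∀ n, 0 < s n := fun n ↦ by positivity
  have hst : ∀ n, s n ≤ t - s n := fun n ↦ by
    have : (2 : ℝ) * s n ≤ t := by
      simp only [s]
      rw [← mul_div_assoc, div_le_iff₀ (by positivity)]
      nlinarith
    linarith
  have hslim : Tendsto s atTop (𝓝 0) := by
    have h := (tendsto_const_div_atTop_nhds_zero_nat (t : ℝ)).comp (tendsto_add_atTop_nat 3)
    refine h.congr fun n ↦ ?_
    simp [s]
  have hsanti : Antitone s := fun m n hmn ↦ by
    simp only [s]
    gcongr
  have hle1 : ∀ n, s n ≤ t := fun n ↦ (hst n).trans (by linarith [hs0 n])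
  have hcont : ContinuousOn (fun u ↦ ∫ r in (0 : ℝ)..u, rate r) (Icc 0 t) := by
    have := intervalIntegral.continuousOn_primitive_interval'
      (a := (0 : ℝ)) hint (left_mem_uIcc)
    rwa [uIcc_of_le ht'.le] at this
  have hIlim : ∀ u : ℕ → ℝ, ∀ x ∈ Icc (0 : ℝ) t, (∀ n, u n ∈ Icc (0 : ℝ) t) →
      Tendsto u atTop (𝓝 x) →
      Tendsto (fun n ↦ ∫ r in (0 : ℝ)..u n, rate r) atTop (𝓝 (∫ r in (0 : ℝ)..x, rate r)) :=
    fun u x hx hu hlim ↦ (hcont x hx).tendsto.comp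
      (tendsto_nhdsWithin_iff.2 ⟨hlim, Eventually.of_forall hu⟩)
  have hsub : ∀ x y, x ∈ Icc (0 : ℝ) t → y ∈ Icc (0 : ℝ) t →
      ∫ r in x..y, rate r = (∫ r in (0 : ℝ)..y, rate r) - ∫ r in (0 : ℝ)..x, rate r := by
    intro x y hx hy
    rw [intervalIntegral.integral_interval_sub_left]
    · exact hint.mono_set (by
        rw [uIcc_of_le hy.1, uIcc_of_le ht'.le]; exact Icc_subset_Icc_right hy.2)
    · exact hint.mono_set (by
        rw [uIcc_of_le hx.1, uIcc_of_le ht'.le]; exact Icc_subset_Icc_right hx.2)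
  have m0 : (0 : ℝ) ∈ Icc (0 : ℝ) t := ⟨le_rfl, ht'.le⟩
  have mt : (t : ℝ) ∈ Icc (0 : ℝ) t := ⟨ht'.le, le_rfl⟩
  have ms : ∀ n, s n ∈ Icc (0 : ℝ) t := fun n ↦ ⟨(hs0 n).le, hle1 n⟩
  have mts : ∀ n, t - s n ∈ Icc (0 : ℝ) t := fun n ↦ ⟨(hs0 n).le.trans (hst n), by linarith [hs0 n]⟩
  have hl0 := hIlim s 0 m0 ms hslim
  rw [intervalIntegral.integral_same] at hl0
  have hl1 := hIlim (fun n ↦ t - s n) t mt mts (by simpa using hslim.const_sub (t : ℝ))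
  have hlimexp : ∀ I : ℕ → ℝ, Tendsto I atTop (𝓝 (∫ r in (0 : ℝ)..t, rate r)) →
      Tendsto (fun n ↦ ENNReal.ofReal (1 / 2 * Real.exp (-I n))) atTop
        (𝓝 (ENNReal.ofReal (1 / 2 * Real.exp (-∫ r in (0 : ℝ)..t, rate r)))) := fun I hI ↦
    ENNReal.tendsto_ofReal (((Real.continuous_exp.tendsto _).comp hI.neg).const_mul _)
  refine le_antisymm ?_ ?_
  · -- no event can occur strictly before time `t`
    refine ge_of_tendsto (hlimexp (fun n ↦ ∫ r in s n..(t - s n), rate r) ?_)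
      (Eventually.of_forall fun n ↦ ?_)
    · simp only [hsub _ _ (ms _) (mts _)]
      simpa using hl1.sub hl0
    · rw [← hprob (s n) (t - s n) (hs0 n) (hst n)]
      refine measure_mono fun ω hω ↦ ?_
      have hall : ∀ r : ℝ, 0 < r → r < t → S r ω = 1 := by
        intro r hr hrt
        by_contra hne
        have hneg : S r ω = -1 := (hS.sign r hr ω).resolve_left hne
        obtain ⟨r', hrr', hr'⟩ : ∃ r' : ℝ, r < r' ∧ ∀ x ∈ Ioo r r', S x ω = -1 := by
          obtain ⟨r', h1, h2⟩ := mem_nhdsGT_iff_exists_Ioo_subset.1 (hS.rightConstant ω r hr)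
          exact ⟨r', h1, fun x hx ↦ (h2 hx).trans hneg⟩
        have hr0 : r < min r' t := lt_min hrr' hrt
        have hlt : ∫ x in (0 : ℝ)..t, v * S x ω < ∫ _ in (0 : ℝ)..t, v := by
          refine
            intervalIntegral.integral_lt_integral_of_ae_le_of_measure_setOfPred_lt_ne_zero ht'.le
            (hS.intervalIntegrable v ω le_rfl ht'.le) (by simp) ?_ ?_
          · filter_upwards [ae_restrict_mem measurableSet_Ioc] with x hx
            rcases hS.sign x hx.1 ω with h | h <;> rw [h] <;> linarith
          · have hIoo : Ioo r (min r' t) ⊆ {x : ℝ | v * S x ω < v} := fun x hx ↦ by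
              have := hr' x ⟨hx.1, hx.2.trans_le (min_le_left _ _)⟩
              simp only [mem_ofPred_eq, this]
              linarith
            intro h0
            have h1 := measure_mono_null hIoo h0
            have hsub' : Ioo r (min r' t) ⊆ Ioc 0 (t : ℝ) := fun x hx ↦
              ⟨hr.trans hx.1, hx.2.le.trans (min_le_right _ _)⟩
            rw [Measure.restrict_apply measurableSet_Ioo,
              inter_eq_self_of_subset_left hsub', Real.volume_Ioo,
              ENNReal.ofReal_eq_zero] at h1
            linarith
        have hω' : U t ω = v * t := hω
        rw [← hUS, hω'] at hlt
        simp [mul_comm] at hlt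
      refine ⟨hall _ (hs0 n) (by linarith [hst n, hs0 n]), ?_⟩
      rw [eventCount_eq_zero_iff (hS.events.finite ω) (hs0 n)]
      refine eq_empty_of_forall_notMem fun x hx ↦ ?_
      have hx0 : 0 < x := (hs0 n).trans hx.2.1
      have hxt : x < t := hx.2.2.trans_lt (by linarith [hs0 n])
      -- just before the event, the sign differs from the sign at the event
      obtain ⟨b, hsb, hbx, hb⟩ := exists_inter_Ioc_eq_singleton
        (hS.events.finite ω (s n) x (hs0 n)) hx.1 hx.2.1
      have hb0 := (hs0 n).trans_le hsb
      have h := hS.switch b x hb0 hbx.le ω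
      rw [hall x hx0 hxt, hall b hb0 (hbx.trans hxt), eventCount, hb, ncard_singleton] at h
      norm_num at h
  · have hset : (⋂ n, {ω | S (s n) ω = 1 ∧ eventCount T (s n) t ω = 0}) ⊆
        {ω | U t ω = v * t} := by
      intro ω hω
      rw [mem_iInter] at hω
      have hall : ∀ r : ℝ, 0 < r → r < t → S r ω = 1 := by
        intro r hr hrt
        obtain ⟨n, hn⟩ := (hslim.eventually (eventually_lt_nhds hr)).exists
        obtain ⟨h1, h2⟩ := hω n
        have h3 := eventCount_add (T := T) (hS.events.finite ω) (hs0 n) hn.le hrt.le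
        rw [hS.switch (s n) r (hs0 n) hn.le, h1, (Nat.add_eq_zero_iff.1 (h3.symm.trans h2)).1,
          pow_zero, mul_one]
      change U t ω = v * t
      rw [hUS, integral_eq_of_forall_eq v ω ht'.le hall, mul_one]
    refine le_trans (le_of_eq ?_) (measure_mono hset)
    have hanti : Antitone fun n ↦ {ω | S (s n) ω = 1 ∧ eventCount T (s n) t ω = 0} := by
      intro m n hmn ω hω
      obtain ⟨h1, h2⟩ := hω
      have h3 := eventCount_add (T := T) (hS.events.finite ω) (hs0 n) (hsanti hmn) (hle1 m)
      have h4 := Nat.add_eq_zero_iff.1 (h3.symm.trans h2)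
      refine ⟨?_, h4.2⟩
      rw [hS.switch (s n) (s m) (hs0 n) (hsanti hmn) ω, h4.1, h1, pow_zero, mul_one]
    have hmeas : ∀ n, NullMeasurableSet {ω | S (s n) ω = 1 ∧ eventCount T (s n) t ω = 0} P :=
      fun n ↦ (((hS.measurable _ (hs0 n)) (measurableSet_singleton 1)).inter
        ((hS.events.measurable (s n) t (hs0 n)) (measurableSet_singleton 0))).nullMeasurableSet
    refine tendsto_nhds_unique (hlimexp (fun n ↦ ∫ r in s n..t, rate r) ?_)
      ((tendsto_measure_iInter_atTop hmeas hanti ⟨0, measure_ne_top _ _⟩).congr fun n ↦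
        hprob (s n) t (hs0 n) (hle1 n))
    simp only [hsub _ _ (ms _) mt]
    simpa using hl0.const_sub (∫ r in (0 : ℝ)..t, rate r)

end

/-! ### Densities of absolutely continuous components -/

section

variable {α β : Type*} [MeasurableSpace α] [MeasurableSpace β]

/-- Where a measure is absolutely continuous, its absolutely continuous component computes it. -/
lemma measure_eq_setLIntegral_rnDeriv {ρ m : Measure α} [SigmaFinite ρ] [SigmaFinite m]
    {s A : Set α} (hs : MeasurableSet s) (h : ρ.restrict s ≪ m) (hA : MeasurableSet A)
    (hAs : A ⊆ s) : ρ A = ∫⁻ x in A, ρ.rnDeriv m x ∂m := by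
  have h0 : ρ.singularPart m A = 0 := by
    have h1 := Measure.singularPart_eq_zero_of_ac h
    rw [Measure.singularPart_restrict _ _ hs] at h1
    have h2 := congrArg (fun κ : Measure α ↦ κ A) h1
    simpa [Measure.restrict_apply hA, inter_eq_self_of_subset_left hAs] using h2
  conv_lhs => rw [Measure.haveLebesgueDecomposition_add ρ m]
  rw [Measure.add_apply, h0, zero_add, withDensity_apply _ hA]

/-- A product is singular as soon as one of its factors is, so that only the product of the
absolutely continuous components contributes to the density. -/
lemma rnDeriv_prod (μ m : Measure α) (ν n : Measure β) [IsFiniteMeasure μ] [SigmaFinite m]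
    [IsFiniteMeasure ν] [SigmaFinite n] :
    (μ.prod ν).rnDeriv (m.prod n) =ᵐ[m.prod n] fun z ↦ μ.rnDeriv m z.1 * ν.rnDeriv n z.2 := by
  have hμ := Measure.haveLebesgueDecomposition_add μ m
  have hν := Measure.haveLebesgueDecomposition_add ν n
  have hsing : ((μ.singularPart m).prod ν +
      (m.withDensity (μ.rnDeriv m)).prod (ν.singularPart n)) ⟂ₘ m.prod n := by
    refine Measure.MutuallySingular.add_left_iff.2 ⟨?_, ?_⟩
    · obtain ⟨N, hN, h1, h2⟩ := Measure.mutuallySingular_singularPart μ m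
      refine ⟨N ×ˢ univ, hN.prod .univ, by simp [h1], ?_⟩
      have : (N ×ˢ (univ : Set β))ᶜ = Nᶜ ×ˢ univ := by ext; simp
      rw [this, Measure.prod_prod, h2, zero_mul]
    · obtain ⟨N, hN, h1, h2⟩ := Measure.mutuallySingular_singularPart ν n
      refine ⟨univ ×ˢ N, MeasurableSet.univ.prod hN, by simp [h1], ?_⟩
      have : ((univ : Set α) ×ˢ N)ᶜ = univ ×ˢ Nᶜ := by ext; simp
      rw [this, Measure.prod_prod, h2, mul_zero]
  refine (Measure.eq_rnDeriv (by fun_prop) hsing ?_).symm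
  rw [← prod_withDensity (by fun_prop) (by fun_prop), add_assoc, ← Measure.prod_add, ← hν,
    ← Measure.add_prod, ← hμ]

end

/-! ### The change of variables `(u, v) ↦ (u + v, u - v)` -/

/-- The linear bijection `(u, v) ↦ (u + v, u - v)` of the plane. -/
noncomputable def sumDiffEquiv : ℝ × ℝ ≃ᵐ ℝ × ℝ where
  toFun p := (p.1 + p.2, p.1 - p.2)
  invFun z := ((z.1 + z.2) / 2, (z.1 - z.2) / 2)
  left_inv p := by ext <;> simp
  right_inv z := by ext <;> simp <;> ring
  measurable_toFun := by simp only [Equiv.coe_fn_mk]; fun_prop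
  measurable_invFun := by simp only [Equiv.coe_fn_symm_mk]; fun_prop

lemma sumDiffEquiv_apply (p : ℝ × ℝ) : sumDiffEquiv p = (p.1 + p.2, p.1 - p.2) := rfl

lemma sumDiffEquiv_symm_apply (z : ℝ × ℝ) :
    sumDiffEquiv.symm z = ((z.1 + z.2) / 2, (z.1 - z.2) / 2) := rfl

lemma map_sumDiffEquiv_volume :
    (volume : Measure (ℝ × ℝ)).map sumDiffEquiv = (2⁻¹ : ℝ≥0∞) • volume := by
  let L : ℝ × ℝ →ₗ[ℝ] ℝ × ℝ :=
    Matrix.toLin (Module.Basis.finTwoProd ℝ) (Module.Basis.finTwoProd ℝ) !![1, 1; 1, -1]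
  have hdet : LinearMap.det L = -2 := by
    rw [LinearMap.det_toLin, Matrix.det_fin_two_of]
    norm_num
  have hL : (sumDiffEquiv : ℝ × ℝ → ℝ × ℝ) = L := by
    ext p
    · simp [L, Matrix.toLin_finTwoProd_apply, sumDiffEquiv_apply]
    · simp [L, Matrix.toLin_finTwoProd_apply, sumDiffEquiv_apply, sub_eq_add_neg]
  rw [hL, Measure.map_linearMap_addHaar_eq_smul_addHaar _ (by rw [hdet]; norm_num), hdet]
  congr 1
  rw [abs_inv, abs_neg, abs_two, ENNReal.ofReal_inv_of_pos two_pos, ENNReal.ofReal_ofNat]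

lemma rnDeriv_map_sumDiffEquiv (μ ν : Measure ℝ) [IsFiniteMeasure μ] [IsFiniteMeasure ν] :
    ((μ.prod ν).map sumDiffEquiv).rnDeriv volume =ᵐ[volume] fun z : ℝ × ℝ ↦
      1 / 2 * μ.rnDeriv volume ((z.1 + z.2) / 2) * ν.rnDeriv volume ((z.1 - z.2) / 2) := by
  have h1 := sumDiffEquiv.measurableEmbedding.rnDeriv_map (μ.prod ν) (volume : Measure (ℝ × ℝ))
  have h2 : ∀ᵐ p : ℝ × ℝ, ((μ.prod ν).map sumDiffEquiv).rnDeriv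
      ((volume : Measure (ℝ × ℝ)).map sumDiffEquiv) (sumDiffEquiv p) =
        μ.rnDeriv volume (sumDiffEquiv.symm (sumDiffEquiv p)).1 *
          ν.rnDeriv volume (sumDiffEquiv.symm (sumDiffEquiv p)).2 := by
    filter_upwards [h1, rnDeriv_prod μ volume ν volume] with p h1 h2
    rw [MeasurableEquiv.symm_apply_apply, h1]
    exact h2
  have h3 := (sumDiffEquiv.measurableEmbedding.ae_map_iff (μ := (volume : Measure (ℝ × ℝ)))
    (p := fun z ↦ ((μ.prod ν).map sumDiffEquiv).rnDeriv
      ((volume : Measure (ℝ × ℝ)).map sumDiffEquiv) z =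
        μ.rnDeriv volume (sumDiffEquiv.symm z).1 * ν.rnDeriv volume (sumDiffEquiv.symm z).2)).2 h2
  rw [map_sumDiffEquiv_volume] at h3
  have h2ne : (2⁻¹ : ℝ≥0∞) ≠ 0 := by simp
  have h4 := (Measure.ae_ennreal_smul_measure_iff h2ne).1 h3
  have h5 := Measure.rnDeriv_smul_right_of_ne_top' ((μ.prod ν).map sumDiffEquiv)
    (volume : Measure (ℝ × ℝ)) h2ne (by simp)
  filter_upwards [h4, h5] with z h4 h5
  rw [h5, Pi.smul_apply, inv_inv, smul_eq_mul, sumDiffEquiv_symm_apply] at h4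
  rw [mul_assoc, ← h4, ← mul_assoc, one_div,
    ENNReal.inv_mul_cancel two_ne_zero ENNReal.ofNat_ne_top, one_mul]

/-- The preimage of the square `{|x| + |y| < 2 a}` is contained in the square
`(-a, a) × (-a, a)`. -/
lemma restrict_map_sumDiffEquiv_absolutelyContinuous {μ ν : Measure ℝ} [IsFiniteMeasure μ]
    [IsFiniteMeasure ν] {a b : ℝ} (hab : b = 2 * a) (hμ : μ.restrict (Ioo (-a) a) ≪ volume)
    (hν : ν.restrict (Ioo (-a) a) ≪ volume) :
    ((μ.prod ν).map sumDiffEquiv).restrict {z | |z.1| + |z.2| < b} ≪ volume := by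
  refine Measure.AbsolutelyContinuous.mk fun B hB hB0 ↦ ?_
  rw [Measure.restrict_apply hB, sumDiffEquiv.map_apply]
  have hsub : sumDiffEquiv ⁻¹' (B ∩ {z | |z.1| + |z.2| < b}) ⊆
      sumDiffEquiv ⁻¹' B ∩ Ioo (-a) a ×ˢ Ioo (-a) a := by
    rintro p ⟨hpB, hp⟩
    refine ⟨hpB, ?_⟩
    simp only [sumDiffEquiv_apply, mem_ofPred_eq] at hp
    have h1 := le_abs_self (p.1 + p.2)
    have h2 := neg_abs_le (p.1 + p.2)
    have h3 := le_abs_self (p.1 - p.2)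
    have h4 := neg_abs_le (p.1 - p.2)
    exact ⟨⟨by linarith, by linarith⟩, ⟨by linarith, by linarith⟩⟩
  refine measure_mono_null hsub ?_
  rw [← Measure.restrict_apply (sumDiffEquiv.measurable hB), ← Measure.prod_restrict]
  refine (hμ.prod hν) ?_
  have h := congrArg (fun κ : Measure (ℝ × ℝ) ↦ κ B) map_sumDiffEquiv_volume
  simp only [sumDiffEquiv.map_apply, Measure.smul_apply, hB0, smul_zero] at h
  exact h

lemma setLIntegral_comp_div_two {g : ℝ → ℝ≥0∞} (A : Set ℝ) :
    ∫⁻ x in (fun x ↦ 2 * x) ⁻¹' A, g x = 2⁻¹ * ∫⁻ η in A, g (η / 2) := by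
  have h : (volume : Measure ℝ) = (2 : ℝ≥0∞) • volume.map (fun x ↦ 2 * x) := by
    have := Real.smul_map_volume_mul_left (two_ne_zero (α := ℝ))
    rw [abs_two, ENNReal.ofReal_ofNat] at this
    exact this.symm
  have he : MeasurableEmbedding fun x : ℝ ↦ 2 * x := measurableEmbedding_mulLeft₀ two_ne_zero
  conv_rhs => rw [h]
  rw [Measure.restrict_smul, lintegral_smul_measure, he.restrict_map, he.lintegral_map, smul_eq_mul,
    ← mul_assoc, ENNReal.inv_mul_cancel two_ne_zero ENNReal.ofNat_ne_top, one_mul]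
  simp

/-! ### The law of the planar motion -/

theorem mainTheorem1 {Ω Ω' : Type*} [MeasurableSpace Ω] [MeasurableSpace Ω']
    (P : Measure Ω) [IsProbabilityMeasure P] (P' : Measure Ω') [IsProbabilityMeasure P']
    (c : ℝ) (hc : 0 < c) (rate : ℝ → ℝ)
    (hrate : ContDiffOn ℝ 2 rate (Ioi 0)) (hrate_nonneg : ∀ t, 0 < t → 0 ≤ rate t)
    (X Y : ℝ≥0 → Ω → ℝ) (hXY : IsStandardOrthogonalMotion c rate X Y P)
    (U V : ℝ≥0 → Ω' → ℝ)
    (hU : IsTelegraphProcess (c / 2) (fun t ↦ rate t / 2) U P')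
    (hV : IsTelegraphProcess (c / 2) (fun t ↦ rate t / 2) V P')
    (hUV : IndepFun (fun ω (t : ℝ≥0) ↦ U t ω) (fun ω (t : ℝ≥0) ↦ V t ω) P') :
    -- equality in distribution of the processes, as random elements of the path space
    IdentDistrib (fun ω (t : ℝ≥0) ↦ (X t ω, Y t ω))
      (fun ω (t : ℝ≥0) ↦ (U t ω + V t ω, U t ω - V t ω)) P P' ∧
    ∀ t : ℝ≥0, 0 < t →
      -- density of the absolutely continuous component
      (acDensity (fun ω ↦ (X t ω, Y t ω)) P =ᵐ[volume] fun z : ℝ × ℝ ↦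
        1 / 2 * acDensity (U t) P' ((z.1 + z.2) / 2) * acDensity (V t) P' ((z.1 - z.2) / 2)) ∧
      -- which is the density of the law in the interior of the square
      (∀ A : Set (ℝ × ℝ), MeasurableSet A → A ⊆ {z | |z.1| + |z.2| < c * t} →
        P {ω | (X t ω, Y t ω) ∈ A} = ∫⁻ z in A,
          1 / 2 * acDensity (U t) P' ((z.1 + z.2) / 2) * acDensity (V t) P' ((z.1 - z.2) / 2)) ∧
      -- density on the edge of the square in the first quadrant
      (IntervalIntegrable rate volume 0 t →
        ∀ A : Set ℝ, MeasurableSet A → A ⊆ Ioo (-(c * t)) (c * t) →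
          P {ω | X t ω + Y t ω = c * t ∧ X t ω - Y t ω ∈ A} = ∫⁻ η in A,
            ENNReal.ofReal (1 / 4 * Real.exp (-(∫ s in (0 : ℝ)..t, rate s) / 2)) *
              acDensity (V t) P' (η / 2)) := by
  have hid := hXY.identDistrib hU hV hUV
  refine ⟨hid, fun t ht ↦ ?_⟩
  have hUm := hU.measurable t
  have hVm := hV.measurable t
  have hc2 : 0 < c / 2 := by linarith
  have hn : ∀ s, 0 < s → 0 ≤ (fun t ↦ rate t / 2) s := fun s hs ↦
    div_nonneg (hrate_nonneg s hs) zero_le_two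
  have hi : ∀ s u, 0 < s → 0 < u → IntervalIntegrable (fun t ↦ rate t / 2) volume s u := by
    intro s u hs hu
    refine ((hrate.continuousOn.mono fun x hx ↦ ?_).intervalIntegrable).div_const 2
    exact (lt_min hs hu).trans_le hx.1
  set μ := P'.map (U t) with hμ
  set ν := P'.map (V t) with hν
  have : IsProbabilityMeasure μ := Measure.isProbabilityMeasure_map hUm.aemeasurable
  have : IsProbabilityMeasure ν := Measure.isProbabilityMeasure_map hVm.aemeasurable
  have hind : IndepFun (U t) (V t) P' :=
    hUV.comp (φ := fun f : ℝ≥0 → ℝ ↦ f t) (ψ := fun f : ℝ≥0 → ℝ ↦ f t)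
      (measurable_pi_apply t) (measurable_pi_apply t)
  have hdist : IdentDistrib (fun ω ↦ (X t ω, Y t ω))
      (fun ω ↦ (U t ω + V t ω, U t ω - V t ω)) P P' :=
    hid.comp (u := fun f : ℝ≥0 → ℝ × ℝ ↦ f t) (measurable_pi_apply t)
  have hlaw : P.map (fun ω ↦ (X t ω, Y t ω)) = (μ.prod ν).map sumDiffEquiv := by
    rw [hdist.map_eq, hμ, hν,
      ← (indepFun_iff_map_prod_eq_prod_map_map hUm.aemeasurable hVm.aemeasurable).1 hind,
      Measure.map_map sumDiffEquiv.measurable (hUm.prodMk hVm)]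
    rfl
  have hac : acDensity (fun ω ↦ (X t ω, Y t ω)) P =ᵐ[volume] fun z : ℝ × ℝ ↦
      1 / 2 * acDensity (U t) P' ((z.1 + z.2) / 2) * acDensity (V t) P' ((z.1 - z.2) / 2) := by
    rw [acDensity, hlaw]
    exact rnDeriv_map_sumDiffEquiv μ ν
  have hUac := hU.restrict_absolutelyContinuous hi hn hc2 ht
  have hVac := hV.restrict_absolutelyContinuous hi hn hc2 ht
  refine ⟨hac, fun A hA hAs ↦ ?_, fun hint A hA hAs ↦ ?_⟩
  · have h := restrict_map_sumDiffEquiv_absolutelyContinuous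
      (show c * t = 2 * (c / 2 * t) by ring) hUac hVac
    have hmeas : MeasurableSet {z : ℝ × ℝ | |z.1| + |z.2| < c * t} :=
      measurableSet_lt (by fun_prop) measurable_const
    rw [← hμ, ← hν, ← hlaw] at h
    have hP : P {ω | (X t ω, Y t ω) ∈ A} = P.map (fun ω ↦ (X t ω, Y t ω)) A :=
      (Measure.map_apply_of_aemeasurable hdist.aemeasurable_fst hA).symm
    have : IsFiniteMeasure (P.map fun ω ↦ (X t ω, Y t ω)) := by rw [hlaw]; infer_instance
    rw [hP, measure_eq_setLIntegral_rnDeriv hmeas h hA hAs]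
    exact lintegral_congr_ae (ae_restrict_of_ae hac)
  · -- on the edge `U t` is at the right end of its range, and `V t` is inside its range
    have hB : MeasurableSet {z : ℝ × ℝ | z.1 + z.2 = c * t ∧ z.1 - z.2 ∈ A} :=
      (measurableSet_eq_fun (by fun_prop) measurable_const).inter
        ((measurable_fst.sub measurable_snd) hA)
    have hA2 : MeasurableSet ((fun x : ℝ ↦ 2 * x) ⁻¹' A) := (measurable_const_mul 2) hA
    have h1 : P {ω | X t ω + Y t ω = c * t ∧ X t ω - Y t ω ∈ A} =
        P' (U t ⁻¹' {c / 2 * t} ∩ V t ⁻¹' ((fun x ↦ 2 * x) ⁻¹' A)) := by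
      refine (hdist.measure_mem_eq hB).trans (congrArg P' ?_)
      ext ω
      have e1 : U t ω + V t ω + (U t ω - V t ω) = 2 * U t ω := by ring
      have e2 : U t ω + V t ω - (U t ω - V t ω) = 2 * V t ω := by ring
      simp only [mem_preimage, mem_ofPred_eq, e1, e2, mem_inter_iff, mem_singleton_iff]
      refine and_congr_left fun _ ↦ ⟨fun h ↦ by linarith, fun h ↦ by linarith⟩
    have h2 : P' (U t ⁻¹' {c / 2 * t}) =
        ENNReal.ofReal (1 / 2 * Real.exp (-(∫ s in (0 : ℝ)..t, rate s) / 2)) := by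
      refine (hU.measure_eq_mul hn hc2 ht (hint.div_const 2)).trans ?_
      rw [intervalIntegral.integral_div, neg_div]
    have hsub : (fun x : ℝ ↦ 2 * x) ⁻¹' A ⊆ Ioo (-(c / 2 * t)) (c / 2 * t) := fun x hx ↦ by
      have := hAs hx
      exact ⟨by linarith [this.1], by linarith [this.2]⟩
    have h3 : P' (V t ⁻¹' ((fun x ↦ 2 * x) ⁻¹' A)) =
        2⁻¹ * ∫⁻ η in A, acDensity (V t) P' (η / 2) := by
      rw [← Measure.map_apply hVm hA2,
        measure_eq_setLIntegral_rnDeriv measurableSet_Ioo hVac hA2 hsub, setLIntegral_comp_div_two]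
      rfl
    have hmeas : Measurable fun η ↦ acDensity (V t) P' (η / 2) :=
      (Measure.measurable_rnDeriv _ _).comp (measurable_id.div_const 2)
    rw [h1, hind.measure_inter_preimage_eq_mul _ _ (measurableSet_singleton _) hA2, h2, h3,
      lintegral_const_mul _ hmeas, ← mul_assoc]
    congr 1
    rw [← ENNReal.ofReal_ofNat 2, ← ENNReal.ofReal_inv_of_pos two_pos,
      ← ENNReal.ofReal_mul (by positivity)]
    congr 1
    ring
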